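/- For $\tau$ in the upper half-plane put $q=e^{2\pi i\tau}$ and $$v(\tau)=q^{1/2}\prod_{n=1}^{\infty}(1-q^n)^{\left(\frac{8}{n}\right)},\qquad q^{1/2}=e^{\pi i\tau},$$ where $\left(\frac{8}{n}\right)=\left(\frac{2}{n}\right)$ is the Kronecker symbol, and let $j=E_4^3/\Delta$ be the modular $j$-invariant, where $E_4$ is the Eisenstein series of weight $4$ for $SL_2(\mathbb{Z})$ with constant term $1$ and $\Delta(\tau)=q\prod_{n\ge 1}(1-q^n)^{24}$. Define the rational functions $$j_2(x)=\frac{(x^8+232x^7+732x^6-1192x^5+710x^4-1192x^3+732x^2+232x+1)^3}{x(x-1)^2(x+1)^4(x^2-6x+1)^8},$$ $$j_{22}(x)=\frac{(x^8-8x^7+12x^6+8x^5-10x^4+8x^3+12x^2-8x+1)^3}{x^8(x-1)^4(x+1)^2(x^2-6x+1)}.$$ Then for every $\tau$ in the upper half-plane the denominators of $j_2$ and $j_{22}$ do not vanish at $v^2(\tau)=v(\tau)^2$, and $$j(\tau)=j_2(v^2(\tau)),\qquad j\left(\frac{-1}{8\tau}\right)=j_{22}(v^2(\tau)).$$ Moreover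 $j_{22}(x)=j_2(t(x))$, where $t(x)=\dfrac{x-\sigma^2}{\sigma^2x-1}$ and $\sigma=-1+\sqrt2$: for every $x\in\mathbb{C}$ at which the denominator of $j_{22}$ does not vanish, $\sigma^2x\ne1$, the denominator of $j_2$ does not vanish at $t(x)$, and $j_{22}(x)=j_2(t(x))$. -/

import Mathlib

open UpperHalfPlane

noncomputable section

namespace OctavicCF

/-- Klein's modular invariant `j = E₄³ / Δ` on the upper half-plane, where `Δ = η ^ 24`,
normalized so that `j = 1/q + 744 + ⋯`. -/
def kleinJ (τ : ℍ) : ℂ :=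
  ModularForm.E₄ τ ^ 3 / ModularForm.discriminant τ

/-- Ramanujan's function `v(τ) = q^(1/2) ∏_{n ≥ 1} (1 - q^n)^((8/n))`, with `q = exp (2πiτ)` and
`q^(1/2) = exp (πiτ)`. The factors of the product are indexed by `m = n - 1`. The exponent is the
Kronecker symbol `(8/n) = (2/n)`, which for even `n` is `0`, as is the Jacobi symbol below. -/
def v (τ : ℍ) : ℂ :=
  Complex.exp (Real.pi * Complex.I * τ) *
    ∏' m : ℕ, (1 - Complex.exp (2 * Real.pi * Complex.I * τ) ^ (m + 1)) ^ (jacobiSym 8 (m + 1))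

/-- The denominator of `j₂`. -/
def j2Den (x : ℂ) : ℂ :=
  x * (x - 1) ^ 2 * (x + 1) ^ 4 * (x ^ 2 - 6 * x + 1) ^ 8

/-- The rational function `j₂`. -/
def j2 (x : ℂ) : ℂ :=
  (x ^ 8 + 232 * x ^ 7 + 732 * x ^ 6 - 1192 * x ^ 5 + 710 * x ^ 4 - 1192 * x ^ 3
    + 732 * x ^ 2 + 232 * x + 1) ^ 3 / j2Den x

/-- The denominator of `j₂₂`. -/
def j22Den (x : ℂ) : ℂ :=
  x ^ 8 * (x - 1) ^ 4 * (x + 1) ^ 2 * (x ^ 2 - 6 * x + 1)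

/-- The rational function `j₂₂`. -/
def j22 (x : ℂ) : ℂ :=
  (x ^ 8 - 8 * x ^ 7 + 12 * x ^ 6 + 8 * x ^ 5 - 10 * x ^ 4 + 8 * x ^ 3
    + 12 * x ^ 2 - 8 * x + 1) ^ 3 / j22Den x

/-- The number `σ = -1 + √2`. -/
def sigma : ℂ := -1 + (Real.sqrt 2 : ℝ)

/-- The linear fractional map `t(x) = (x - σ²) / (σ² x - 1)`. -/
def t (x : ℂ) : ℂ := (x - sigma ^ 2) / (sigma ^ 2 * x - 1)

/-- The point `-1 / (8τ)` of the upper half-plane. -/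
def fricke (τ : ℍ) : ℍ :=
  ⟨-1 / (8 * (τ : ℂ)), by
    have h : (0 : ℝ) < ((8 : ℂ) * (τ : ℂ)).im := by
      simpa using τ.im_pos
    have h0 : (8 : ℂ) * (τ : ℂ) ≠ 0 := by
      intro h1
      simp [h1] at h
    have h2 : (-1 / (8 * (τ : ℂ))).im
        = ((8 : ℂ) * (τ : ℂ)).im / Complex.normSq (8 * (τ : ℂ)) := by
      rw [neg_div, one_div, Complex.neg_im, Complex.inv_im, neg_div, neg_neg]
    rw [h2]
    exact div_pos h (Complex.normSq_pos.mpr h0)⟩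

end OctavicCF

end

/-! Write x = v(τ)², φ(q) = θ₃(2τ) and ψ(q) = Σ q^(2n²+n). The Jacobi triple product at z = 1/2 + τ
and z = 1/2 + 3τ, with period 8τ, turns the product for v into a quotient of theta series: x =
q·N²/D² with N = f(-q, -q⁷) and D = f(-q³, -q⁵) (`v_sq_mul`). The addition formula gives the
factorizations D² + qN² = ψ(q) θ₄(4τ) and D² - qN² = ψ(-q) θ₃(4τ). Eliminating ψ yields the key
relation θ₂(4τ)² (1 - x)² = 4x θ₃(4τ)² (`v_sq_relation`), so x determines the ratio θ₂²/θ₃² at 4τ.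

On the other side, dimension arguments at level one give 2E₄ = θ₂⁸ + θ₃⁸ + θ₄⁸ and 256Δ = θ₂⁸θ₃⁸θ₄⁸.
Hence j is a rational function of theta constants, none of which vanishes because Δ does not.
Duplication formulas move the constants at τ and at 8τ to 4τ. Both quotients are homogeneous of
degree 0 in θ₂(4τ)², θ₃(4τ)², so they are rational in x: j(τ) gives j₂, and j(-1/(8τ)) = j(8τ) gives
j₂₂. The denominators are nonzero because their factors are governed by nonvanishing theta
constants.

The last claim is pure algebra: σ² is a root of X² - 6X + 1, and t permutes the factors of the two
denominators. -/

namespace JacobiTheta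

/-! ### Theta series: addition formula, dissection and duplication -/

/-- The map `(s, t) ↦ (s + t, s - t)`, together with its translate by `(1, 0)`, is a bijection
onto `ℤ × ℤ`. -/
noncomputable def sumDiffEquiv : (ℤ × ℤ) ⊕ (ℤ × ℤ) ≃ ℤ × ℤ :=
  Equiv.ofBijective
    (Sum.elim (fun p => (p.1 + p.2, p.1 - p.2)) fun p => (p.1 + p.2 + 1, p.1 - p.2)) <| by
    constructor
    · rintro (⟨a, b⟩ | ⟨a, b⟩) (⟨c, d⟩ | ⟨c, d⟩) h <;>
        simp only [Sum.elim_inl, Sum.elim_inr, Prod.mk.injEq, Sum.inl.injEq, Sum.inr.injEq,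
          reduceCtorEq] at h ⊢ <;> omega
    · rintro ⟨m, n⟩
      rcases Int.even_or_odd' (m + n) with ⟨s, hs | hs⟩
      · exact ⟨Sum.inl (s, s - n), by
          simp only [Sum.elim_inl, Prod.mk.injEq]; omega⟩
      · exact ⟨Sum.inr (s, s - n), by
          simp only [Sum.elim_inr, Prod.mk.injEq]; omega⟩

/-- Every integer is either even or odd. -/
noncomputable def evenOddEquiv : ℤ ⊕ ℤ ≃ ℤ :=
  Equiv.ofBijective (Sum.elim (fun n => 2 * n) fun n => 2 * n + 1) <| by
    constructor
    · rintro (a | a) (c | c) h <;>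
        simp only [Sum.elim_inl, Sum.elim_inr, Sum.inl.injEq, Sum.inr.injEq,
          reduceCtorEq] at h ⊢ <;> omega
    · intro m
      rcases Int.even_or_odd' m with ⟨s, hs | hs⟩
      · exact ⟨Sum.inl s, by simp only [Sum.elim_inl]; omega⟩
      · exact ⟨Sum.inr s, by simp only [Sum.elim_inr]; omega⟩

theorem sumDiffEquiv_inl (p : ℤ × ℤ) : sumDiffEquiv (Sum.inl p) = (p.1 + p.2, p.1 - p.2) := rfl

theorem sumDiffEquiv_inr (p : ℤ × ℤ) :
    sumDiffEquiv (Sum.inr p) = (p.1 + p.2 + 1, p.1 - p.2) := rfl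

theorem evenOddEquiv_inl (n : ℤ) : evenOddEquiv (Sum.inl n) = 2 * n := rfl

theorem evenOddEquiv_inr (n : ℤ) : evenOddEquiv (Sum.inr n) = 2 * n + 1 := rfl

variable {τ : ℂ}

theorem _root_.HasSum.mul_complex {ι : Type*} {f g : ι → ℂ} {a b : ℂ} (hf : HasSum f a)
    (hg : HasSum g b) : HasSum (fun p : ι × ι => f p.1 * g p.2) (a * b) :=
  hf.mul hg (summable_mul_of_summable_norm hf.summable.norm hg.summable.norm)

theorem hasSum_mul (z w : ℂ) (hτ : 0 < τ.im) :
    HasSum (fun p : ℤ × ℤ => jacobiTheta₂_term p.1 z τ * jacobiTheta₂_term p.2 w τ)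
      (jacobiTheta₂ z τ * jacobiTheta₂ w τ) := by
  have h := (hasSum_jacobiTheta₂_term z hτ).mul_complex (hasSum_jacobiTheta₂_term w hτ)
  exact h

theorem two_mul_im_pos (hτ : 0 < τ.im) : 0 < (2 * τ).im := by simpa using hτ

theorem four_mul_im_pos (hτ : 0 < τ.im) : 0 < (4 * τ).im := by simpa using hτ

theorem eight_mul_im_pos (hτ : 0 < τ.im) : 0 < (8 * τ).im := by simpa using hτ

/-- The addition formula for products of two theta functions. -/
theorem jacobiTheta₂_mul (z w : ℂ) (hτ : 0 < τ.im) :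
    jacobiTheta₂ z τ * jacobiTheta₂ w τ =
      jacobiTheta₂ (z + w) (2 * τ) * jacobiTheta₂ (z - w) (2 * τ) +
        Complex.exp (Real.pi * Complex.I * (τ + 2 * z)) *
          (jacobiTheta₂ (z + w + τ) (2 * τ) * jacobiTheta₂ (z - w + τ) (2 * τ)) := by
  have h2 := two_mul_im_pos hτ
  refine (hasSum_mul z w hτ).unique ?_
  rw [← sumDiffEquiv.hasSum_iff]
  refine HasSum.sum ((hasSum_mul _ _ h2).congr_fun fun p => ?_)
    (((hasSum_mul _ _ h2).mul_left _).congr_fun fun p => ?_)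
  all_goals
    simp only [sumDiffEquiv_inl, sumDiffEquiv_inr, Function.comp_apply, jacobiTheta₂_term,
      ← Complex.exp_add]
    congr 1
    push_cast
    ring

/-- Dissection of a theta series into even and odd terms. -/
theorem jacobiTheta₂_eq_even_add_odd (z : ℂ) (hτ : 0 < τ.im) :
    jacobiTheta₂ z τ = jacobiTheta₂ (2 * z) (4 * τ) +
      Complex.exp (Real.pi * Complex.I * (τ + 2 * z)) *
        jacobiTheta₂ (2 * z + 2 * τ) (4 * τ) := by
  have h4 := four_mul_im_pos hτ
  refine (hasSum_jacobiTheta₂_term z hτ).unique ?_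
  rw [← evenOddEquiv.hasSum_iff]
  refine HasSum.sum ((hasSum_jacobiTheta₂_term _ h4).congr_fun fun p => ?_)
    (((hasSum_jacobiTheta₂_term _ h4).mul_left _).congr_fun fun p => ?_)
  all_goals
    simp only [evenOddEquiv_inl, evenOddEquiv_inr, Function.comp_apply, jacobiTheta₂_term,
      ← Complex.exp_add]
    congr 1
    push_cast
    ring

theorem jacobiTheta₂_reflect (z τ : ℂ) :
    jacobiTheta₂ (τ - z) τ =
      Complex.exp (-Real.pi * Complex.I * (τ - 2 * z)) * jacobiTheta₂ z τ := by
  have := jacobiTheta₂_add_left' (-z) τ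
  rw [jacobiTheta₂_neg_left] at this
  rw [sub_eq_neg_add, this]
  ring_nf

/-- A theta function with half-integral characteristic vanishes. -/
theorem jacobiTheta₂_half_period (τ : ℂ) : jacobiTheta₂ (1 / 2 + τ / 2) τ = 0 := by
  have h := jacobiTheta₂_reflect (1 / 2 + τ / 2) τ
  have e : τ - (1 / 2 + τ / 2) = -(1 / 2 + τ / 2) + τ := by ring
  have e' : jacobiTheta₂ (τ - (1 / 2 + τ / 2)) τ = jacobiTheta₂ (1 / 2 + τ / 2) τ := by
    rw [← jacobiTheta₂_add_left]
    ring_nf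
  have e'' : -Real.pi * Complex.I * (τ - 2 * (1 / 2 + τ / 2)) = Real.pi * Complex.I := by ring
  rw [e', e'', Complex.exp_pi_mul_I] at h
  linear_combination h / 2

/-- The theta constant `θ₂`. -/
noncomputable def theta2 (τ : ℂ) : ℂ :=
  Complex.exp (Real.pi * Complex.I * τ / 4) * jacobiTheta₂ (τ / 2) τ

/-- The theta constant `θ₃`. -/
noncomputable def theta3 (τ : ℂ) : ℂ := jacobiTheta₂ 0 τ

/-- The theta constant `θ₄`. -/
noncomputable def theta4 (τ : ℂ) : ℂ := jacobiTheta₂ (1 / 2) τ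

theorem theta3_sq (hτ : 0 < τ.im) :
    theta3 τ ^ 2 = theta3 (2 * τ) ^ 2 + theta2 (2 * τ) ^ 2 := by
  simp only [theta2, theta3]
  rw [sq, jacobiTheta₂_mul _ _ hτ, mul_pow, ← Complex.exp_nat_mul]
  ring_nf

theorem theta4_sq (hτ : 0 < τ.im) :
    theta4 τ ^ 2 = theta3 (2 * τ) ^ 2 - theta2 (2 * τ) ^ 2 := by
  simp only [theta2, theta3, theta4]
  have h1 : jacobiTheta₂ (1 / 2 + 1 / 2) (2 * τ) = jacobiTheta₂ 0 (2 * τ) := by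
    rw [← jacobiTheta₂_add_left 0]; ring_nf
  have h2 : jacobiTheta₂ (1 / 2 + 1 / 2 + τ) (2 * τ) = jacobiTheta₂ τ (2 * τ) := by
    rw [← jacobiTheta₂_add_left τ]; ring_nf
  have h3 : Complex.exp (Real.pi * Complex.I * (τ + 2 * (1 / 2))) =
      -Complex.exp (Real.pi * Complex.I * τ) := by
    rw [mul_add, Complex.exp_add]; simp
  rw [sq, jacobiTheta₂_mul _ _ hτ, mul_pow, ← Complex.exp_nat_mul, h1, h2, h3]
  ring_nf

theorem theta2_sq (hτ : 0 < τ.im) :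
    theta2 τ ^ 2 = 2 * theta2 (2 * τ) * theta3 (2 * τ) := by
  simp only [theta2, theta3]
  have h1 : jacobiTheta₂ (τ / 2 + τ / 2 + τ) (2 * τ) =
      Complex.exp (-Real.pi * Complex.I * (2 * τ)) * jacobiTheta₂ 0 (2 * τ) := by
    have := jacobiTheta₂_reflect 0 (2 * τ)
    simp only [mul_zero, sub_zero] at this
    rw [← this]; ring_nf
  have h2 : Complex.exp (Real.pi * Complex.I * (τ + 2 * (τ / 2))) *
      Complex.exp (-Real.pi * Complex.I * (2 * τ)) = 1 := by
    rw [← Complex.exp_add, Complex.exp_eq_one_iff]; exact ⟨0, by push_cast; ring⟩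
  have h3 : Complex.exp (Real.pi * Complex.I * τ / 4) ^ 2 =
      Complex.exp (Real.pi * Complex.I * (2 * τ) / 4) := by
    rw [← Complex.exp_nat_mul]; ring_nf
  rw [mul_pow, sq (jacobiTheta₂ _ _), jacobiTheta₂_mul _ _ hτ, h1, h3]
  have e1 : τ / 2 + τ / 2 = 2 * τ / 2 := by ring
  have e2 : τ / 2 - τ / 2 = 0 := by ring
  have e3 : (0 : ℂ) + τ = 2 * τ / 2 := by ring
  rw [e1, e2, e3]
  linear_combination Complex.exp (Real.pi * Complex.I * (2 * τ) / 4) *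
    jacobiTheta₂ 0 (2 * τ) * jacobiTheta₂ (2 * τ / 2) (2 * τ) * h2

/-- Jacobi's quartic identity. -/
theorem theta4_pow_four (hτ : 0 < τ.im) : theta4 τ ^ 4 = theta3 τ ^ 4 - theta2 τ ^ 4 := by
  linear_combination (theta4 τ ^ 2 + theta3 (2 * τ) ^ 2 - theta2 (2 * τ) ^ 2) * theta4_sq hτ -
    (theta3 τ ^ 2 + theta3 (2 * τ) ^ 2 + theta2 (2 * τ) ^ 2) * theta3_sq hτ +
    (theta2 τ ^ 2 + 2 * theta2 (2 * τ) * theta3 (2 * τ)) * theta2_sq hτ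

/-- Landen's transformation in the variable `z`. -/
theorem jacobiTheta₂_mul_add_half (z : ℂ) (hτ : 0 < τ.im) :
    jacobiTheta₂ z τ * jacobiTheta₂ (z + 1 / 2) τ =
      jacobiTheta₂ (2 * z + 1 / 2) (2 * τ) * theta4 (2 * τ) := by
  -- The second product of the addition formula dies: τ - 1/2 is, modulo 1, the zero of the theta
  -- function of period 2τ.
  have h0 : jacobiTheta₂ (z - (z + 1 / 2) + τ) (2 * τ) = 0 := by
    rw [← jacobiTheta₂_half_period (2 * τ), ← jacobiTheta₂_add_left]
    ring_nf
  have h1 : jacobiTheta₂ (z - (z + 1 / 2)) (2 * τ) = theta4 (2 * τ) := by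
    rw [theta4, ← jacobiTheta₂_neg_left]; ring_nf
  rw [jacobiTheta₂_mul _ _ hτ, h0, h1]
  ring_nf

theorem theta3_mul_theta4 (hτ : 0 < τ.im) : theta3 τ * theta4 τ = theta4 (2 * τ) ^ 2 := by
  have := jacobiTheta₂_mul_add_half 0 hτ
  simp only [mul_zero, zero_add] at this
  unfold theta3 theta4 at *
  rw [this]; ring

end JacobiTheta

/-! ### Ramanujan's ψ and the Göllnitz–Gordon theta functions -/

namespace JacobiTheta

variable {τ : ℂ}

/-- Used to fold arguments beyond half a period back, such as 10τ to 6τ for period 16τ, so that all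
dissections share the same four series. -/
theorem exp_mul_jacobiTheta₂_reflect (z τ : ℂ) :
    Complex.exp (Real.pi * Complex.I * (τ - 2 * z)) * jacobiTheta₂ (τ - z) τ =
      jacobiTheta₂ z τ := by
  rw [jacobiTheta₂_reflect, ← mul_assoc, ← Complex.exp_add]
  ring_nf
  simp

theorem exp_even_mul (k : ℕ) (τ : ℂ) :
    Complex.exp (Real.pi * Complex.I * (2 * k * τ)) =
      Complex.exp (2 * Real.pi * Complex.I * τ) ^ k := by
  rw [← Complex.exp_nat_mul]; ring_nf

theorem exp_even_mul_add_one (k : ℕ) (τ : ℂ) :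
    Complex.exp (Real.pi * Complex.I * (2 * k * τ + 1)) =
      -Complex.exp (2 * Real.pi * Complex.I * τ) ^ k := by
  rw [← exp_even_mul, mul_add, Complex.exp_add]; simp

/-- `f(-q³, -q⁵)` in Ramanujan's notation. -/
noncomputable def goellnitzDen (τ : ℂ) : ℂ := jacobiTheta₂ (1 / 2 + τ) (8 * τ)

/-- `f(-q, -q⁷)` in Ramanujan's notation. -/
noncomputable def goellnitzNum (τ : ℂ) : ℂ := jacobiTheta₂ (1 / 2 + 3 * τ) (8 * τ)

theorem psi_eq (hτ : 0 < τ.im) :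
    jacobiTheta₂ τ (4 * τ) = jacobiTheta₂ (2 * τ) (16 * τ) +
      Complex.exp (2 * Real.pi * Complex.I * τ) * jacobiTheta₂ (6 * τ) (16 * τ) := by
  have h := jacobiTheta₂_eq_even_add_odd τ (four_mul_im_pos hτ)
  have r := exp_mul_jacobiTheta₂_reflect (6 * τ) (16 * τ)
  rw [show (16 * τ - 2 * (6 * τ)) = 2 * (2 : ℕ) * τ by push_cast; ring,
    show 16 * τ - 6 * τ = 10 * τ by ring, exp_even_mul] at r
  rw [show 4 * τ + 2 * τ = 2 * (3 : ℕ) * τ by push_cast; ring, exp_even_mul,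
    show 2 * τ + 2 * (4 * τ) = 10 * τ by ring, show 4 * (4 * τ) = 16 * τ by ring] at h
  linear_combination h + Complex.exp (2 * Real.pi * Complex.I * τ) * r

theorem psi_neg_eq (hτ : 0 < τ.im) :
    jacobiTheta₂ (τ + 1 / 2) (4 * τ) = jacobiTheta₂ (2 * τ) (16 * τ) -
      Complex.exp (2 * Real.pi * Complex.I * τ) * jacobiTheta₂ (6 * τ) (16 * τ) := by
  have h := jacobiTheta₂_eq_even_add_odd (τ + 1 / 2) (four_mul_im_pos hτ)
  have r := exp_mul_jacobiTheta₂_reflect (6 * τ) (16 * τ)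
  rw [show (16 * τ - 2 * (6 * τ)) = 2 * (2 : ℕ) * τ by push_cast; ring,
    show 16 * τ - 6 * τ = 10 * τ by ring, exp_even_mul] at r
  rw [show 4 * τ + 2 * (τ + 1 / 2) = 2 * (3 : ℕ) * τ + 1 by push_cast; ring,
    exp_even_mul_add_one, show 2 * (τ + 1 / 2) + 2 * (4 * τ) = 10 * τ + 1 by ring,
    show 2 * (τ + 1 / 2) = 2 * τ + 1 by ring, show 4 * (4 * τ) = 16 * τ by ring,
    jacobiTheta₂_add_left, jacobiTheta₂_add_left] at h
  linear_combination h - Complex.exp (2 * Real.pi * Complex.I * τ) * r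

theorem theta3_four_mul (hτ : 0 < τ.im) :
    theta3 (4 * τ) = jacobiTheta₂ 0 (16 * τ) +
      Complex.exp (2 * Real.pi * Complex.I * τ) ^ 2 * jacobiTheta₂ (8 * τ) (16 * τ) := by
  have h := jacobiTheta₂_eq_even_add_odd 0 (four_mul_im_pos hτ)
  rw [show 4 * τ + 2 * 0 = 2 * (2 : ℕ) * τ by push_cast; ring, exp_even_mul] at h
  rw [theta3, h]
  ring_nf

theorem theta4_four_mul (hτ : 0 < τ.im) :
    theta4 (4 * τ) = jacobiTheta₂ 0 (16 * τ) -
      Complex.exp (2 * Real.pi * Complex.I * τ) ^ 2 * jacobiTheta₂ (8 * τ) (16 * τ) := by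
  have h := jacobiTheta₂_eq_even_add_odd (1 / 2) (four_mul_im_pos hτ)
  rw [show 4 * τ + 2 * (1 / 2) = 2 * (2 : ℕ) * τ + 1 by push_cast; ring, exp_even_mul_add_one,
    show 2 * (1 / 2 : ℂ) + 2 * (4 * τ) = 8 * τ + 1 by ring,
    show 2 * (1 / 2 : ℂ) = 0 + 1 by ring, jacobiTheta₂_add_left, jacobiTheta₂_add_left] at h
  rw [theta4, h]
  ring_nf

theorem theta3_two_mul (hτ : 0 < τ.im) :
    theta3 (2 * τ) = jacobiTheta₂ 0 (8 * τ) +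
      Complex.exp (2 * Real.pi * Complex.I * τ) * jacobiTheta₂ (4 * τ) (8 * τ) := by
  have h := jacobiTheta₂_eq_even_add_odd 0 (two_mul_im_pos hτ)
  rw [show 2 * τ + 2 * 0 = 2 * (1 : ℕ) * τ by push_cast; ring, exp_even_mul] at h
  rw [theta3, h]
  ring_nf

theorem theta4_two_mul (hτ : 0 < τ.im) :
    theta4 (2 * τ) = jacobiTheta₂ 0 (8 * τ) -
      Complex.exp (2 * Real.pi * Complex.I * τ) * jacobiTheta₂ (4 * τ) (8 * τ) := by
  have h := jacobiTheta₂_eq_even_add_odd (1 / 2) (two_mul_im_pos hτ)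
  rw [show 2 * τ + 2 * (1 / 2) = 2 * (1 : ℕ) * τ + 1 by push_cast; ring, exp_even_mul_add_one,
    show 2 * (1 / 2 : ℂ) + 2 * (2 * τ) = 4 * τ + 1 by ring,
    show 2 * (1 / 2 : ℂ) = 0 + 1 by ring, jacobiTheta₂_add_left, jacobiTheta₂_add_left] at h
  rw [theta4, h]
  ring_nf

/-- `ψ(q)² = φ(q) ψ(q²)`. -/
theorem psi_sq (hτ : 0 < τ.im) :
    jacobiTheta₂ τ (4 * τ) ^ 2 = theta3 (2 * τ) * jacobiTheta₂ (2 * τ) (8 * τ) := by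
  have h := jacobiTheta₂_mul τ τ (four_mul_im_pos hτ)
  have r := exp_mul_jacobiTheta₂_reflect (2 * τ) (8 * τ)
  rw [show (8 * τ - 2 * (2 * τ)) = 2 * (2 : ℕ) * τ by push_cast; ring,
    show 8 * τ - 2 * τ = 6 * τ by ring, exp_even_mul] at r
  rw [show 4 * τ + 2 * τ = 2 * (3 : ℕ) * τ by push_cast; ring, exp_even_mul,
    show τ + τ + 4 * τ = 6 * τ by ring, show τ - τ + 4 * τ = 4 * τ by ring,
    show 2 * (4 * τ) = 8 * τ by ring, show τ + τ = 2 * τ by ring, sub_self] at h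
  rw [theta3_two_mul hτ]
  linear_combination h + Complex.exp (2 * Real.pi * Complex.I * τ) *
    jacobiTheta₂ (4 * τ) (8 * τ) * r

/-- `ψ(-q)² = φ(-q) ψ(q²)`. -/
theorem psi_neg_sq (hτ : 0 < τ.im) :
    jacobiTheta₂ (τ + 1 / 2) (4 * τ) ^ 2 = theta4 (2 * τ) * jacobiTheta₂ (2 * τ) (8 * τ) := by
  have h := jacobiTheta₂_mul (τ + 1 / 2) (τ + 1 / 2) (four_mul_im_pos hτ)
  have r := exp_mul_jacobiTheta₂_reflect (2 * τ) (8 * τ)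
  rw [show (8 * τ - 2 * (2 * τ)) = 2 * (2 : ℕ) * τ by push_cast; ring,
    show 8 * τ - 2 * τ = 6 * τ by ring, exp_even_mul] at r
  rw [show 4 * τ + 2 * (τ + 1 / 2) = 2 * (3 : ℕ) * τ + 1 by push_cast; ring,
    exp_even_mul_add_one, sub_self, zero_add,
    show τ + 1 / 2 + (τ + 1 / 2) + 4 * τ = 6 * τ + 1 by ring,
    show 2 * (4 * τ) = 8 * τ by ring, show τ + 1 / 2 + (τ + 1 / 2) = 2 * τ + 1 by ring,
    jacobiTheta₂_add_left, jacobiTheta₂_add_left] at h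
  rw [theta4_two_mul hτ]
  linear_combination h - Complex.exp (2 * Real.pi * Complex.I * τ) *
    jacobiTheta₂ (4 * τ) (8 * τ) * r

theorem goellnitzDen_sq (hτ : 0 < τ.im) :
    goellnitzDen τ ^ 2 = jacobiTheta₂ (2 * τ) (16 * τ) * jacobiTheta₂ 0 (16 * τ) -
      Complex.exp (2 * Real.pi * Complex.I * τ) ^ 3 * jacobiTheta₂ (6 * τ) (16 * τ) *
        jacobiTheta₂ (8 * τ) (16 * τ) := by
  have h := jacobiTheta₂_mul (1 / 2 + τ) (1 / 2 + τ) (eight_mul_im_pos hτ)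
  have r := exp_mul_jacobiTheta₂_reflect (6 * τ) (16 * τ)
  rw [show (16 * τ - 2 * (6 * τ)) = 2 * (2 : ℕ) * τ by push_cast; ring,
    show 16 * τ - 6 * τ = 10 * τ by ring, exp_even_mul] at r
  rw [show 8 * τ + 2 * (1 / 2 + τ) = 2 * (5 : ℕ) * τ + 1 by push_cast; ring,
    exp_even_mul_add_one, sub_self, zero_add,
    show 1 / 2 + τ + (1 / 2 + τ) + 8 * τ = 10 * τ + 1 by ring,
    show 2 * (8 * τ) = 16 * τ by ring, show 1 / 2 + τ + (1 / 2 + τ) = 2 * τ + 1 by ring,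
    jacobiTheta₂_add_left, jacobiTheta₂_add_left] at h
  rw [goellnitzDen]
  linear_combination h - Complex.exp (2 * Real.pi * Complex.I * τ) ^ 3 *
    jacobiTheta₂ (8 * τ) (16 * τ) * r

theorem goellnitzNum_sq (hτ : 0 < τ.im) :
    goellnitzNum τ ^ 2 = jacobiTheta₂ (6 * τ) (16 * τ) * jacobiTheta₂ 0 (16 * τ) -
      Complex.exp (2 * Real.pi * Complex.I * τ) * jacobiTheta₂ (2 * τ) (16 * τ) *
        jacobiTheta₂ (8 * τ) (16 * τ) := by
  have h := jacobiTheta₂_mul (1 / 2 + 3 * τ) (1 / 2 + 3 * τ) (eight_mul_im_pos hτ)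
  have r := exp_mul_jacobiTheta₂_reflect (2 * τ) (16 * τ)
  rw [show (16 * τ - 2 * (2 * τ)) = 2 * (6 : ℕ) * τ by push_cast; ring,
    show 16 * τ - 2 * τ = 14 * τ by ring, exp_even_mul] at r
  rw [show 8 * τ + 2 * (1 / 2 + 3 * τ) = 2 * (7 : ℕ) * τ + 1 by push_cast; ring,
    exp_even_mul_add_one, sub_self, zero_add,
    show 1 / 2 + 3 * τ + (1 / 2 + 3 * τ) + 8 * τ = 14 * τ + 1 by ring,
    show 2 * (8 * τ) = 16 * τ by ring,
    show 1 / 2 + 3 * τ + (1 / 2 + 3 * τ) = 6 * τ + 1 by ring,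
    jacobiTheta₂_add_left, jacobiTheta₂_add_left] at h
  rw [goellnitzNum]
  linear_combination h - Complex.exp (2 * Real.pi * Complex.I * τ) *
    jacobiTheta₂ (8 * τ) (16 * τ) * r

/-- With A, B, C, E the series of period 16τ at 2τ, 6τ, 0, 8τ, the squares are AC - q³BE and BC -
qAE, and the combination factors as (A + qB)(C - q²E). The opposite sign gives (A - qB)(C + q²E). -/
theorem goellnitz_add (hτ : 0 < τ.im) :
    goellnitzDen τ ^ 2 + Complex.exp (2 * Real.pi * Complex.I * τ) * goellnitzNum τ ^ 2 =
      jacobiTheta₂ τ (4 * τ) * theta4 (4 * τ) := by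
  rw [goellnitzDen_sq hτ, goellnitzNum_sq hτ, psi_eq hτ, theta4_four_mul hτ]
  ring

theorem goellnitz_sub (hτ : 0 < τ.im) :
    goellnitzDen τ ^ 2 - Complex.exp (2 * Real.pi * Complex.I * τ) * goellnitzNum τ ^ 2 =
      jacobiTheta₂ (τ + 1 / 2) (4 * τ) * theta3 (4 * τ) := by
  rw [goellnitzDen_sq hτ, goellnitzNum_sq hτ, psi_neg_eq hτ, theta3_four_mul hτ]
  ring

/-- Eliminates ψ: both ψ(q)² and ψ(-q)² contain ψ(q²), with cofactors θ₃(2τ) and θ₄(2τ), while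
θ₄(4τ)² = θ₃(2τ) θ₄(2τ). -/
theorem goellnitz_add_sq_mul (hτ : 0 < τ.im) :
    (goellnitzDen τ ^ 2 + Complex.exp (2 * Real.pi * Complex.I * τ) * goellnitzNum τ ^ 2) ^ 2 *
        theta3 (4 * τ) ^ 2 =
      (goellnitzDen τ ^ 2 - Complex.exp (2 * Real.pi * Complex.I * τ) * goellnitzNum τ ^ 2) ^ 2 *
        theta3 (2 * τ) ^ 2 := by
  have h := theta3_mul_theta4 (two_mul_im_pos hτ)
  rw [show 2 * (2 * τ) = 4 * τ by ring] at h
  rw [goellnitz_add hτ, goellnitz_sub hτ]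
  linear_combination theta4 (4 * τ) ^ 2 * theta3 (4 * τ) ^ 2 * psi_sq hτ -
    theta3 (4 * τ) ^ 2 * theta3 (2 * τ) ^ 2 * psi_neg_sq hτ -
    theta3 (2 * τ) * jacobiTheta₂ (2 * τ) (8 * τ) * theta3 (4 * τ) ^ 2 * h

/-- `θ₂(τ) = 2 q^(1/8) ψ(q)`. -/
theorem theta2_eq_psi (hτ : 0 < τ.im) :
    theta2 τ = 2 * Complex.exp (Real.pi * Complex.I * τ / 4) * jacobiTheta₂ τ (4 * τ) := by
  have h := jacobiTheta₂_eq_even_add_odd (τ / 2) hτ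
  have r := exp_mul_jacobiTheta₂_reflect τ (4 * τ)
  rw [show 4 * τ - 2 * τ = 2 * (1 : ℕ) * τ by push_cast; ring,
    show 4 * τ - τ = 3 * τ by ring, exp_even_mul, pow_one] at r
  rw [show τ + 2 * (τ / 2) = 2 * (1 : ℕ) * τ by push_cast; ring, exp_even_mul, pow_one,
    show 2 * (τ / 2) = τ by ring, show τ + 2 * τ = 3 * τ by ring, r] at h
  rw [theta2, h]
  ring

end JacobiTheta

/-! ### Theta constants under τ + 1 and -1/τ, and at i∞ -/

namespace JacobiTheta

variable {τ : ℂ}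

/-- Since n² and n have the same parity, exp(πi n²) = exp(πi n), which is the effect of shifting z
by 1/2. -/
theorem jacobiTheta₂_translate (z τ : ℂ) :
    jacobiTheta₂ z (τ + 1) = jacobiTheta₂ (z + 1 / 2) τ := by
  refine tsum_congr fun n => ?_
  obtain ⟨m, hm⟩ : Even (n * (n - 1)) := Int.even_mul_pred_self n
  have hm' : (n : ℂ) * (n - 1) = m + m := mod_cast hm
  rw [jacobiTheta₂_term, jacobiTheta₂_term, Complex.exp_eq_exp_iff_exists_int]
  exact ⟨m, by linear_combination Real.pi * Complex.I * hm'⟩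

theorem theta3_add_one (τ : ℂ) : theta3 (τ + 1) = theta4 τ := by
  rw [theta3, jacobiTheta₂_translate, theta4, zero_add]

theorem theta4_add_one (τ : ℂ) : theta4 (τ + 1) = theta3 τ := by
  rw [theta3, theta4, jacobiTheta₂_translate, ← jacobiTheta₂_add_left 0]
  ring_nf

theorem theta2_add_one_pow (τ : ℂ) : theta2 (τ + 1) ^ 8 = theta2 τ ^ 8 := by
  have h : jacobiTheta₂ ((τ + 1) / 2) (τ + 1) = jacobiTheta₂ (τ / 2) τ := by
    rw [jacobiTheta₂_translate, ← jacobiTheta₂_add_left (τ / 2)]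
    ring_nf
  rw [theta2, theta2, h, mul_pow, mul_pow, ← Complex.exp_nat_mul, ← Complex.exp_nat_mul]
  congr 1
  rw [Complex.exp_eq_exp_iff_exists_int]
  exact ⟨1, by push_cast; ring⟩

/-- The automorphy factor of the theta constants under inversion. -/
noncomputable def inversionFactor (τ : ℂ) : ℂ := 1 / (-Complex.I * τ) ^ (1 / 2 : ℂ)

/-- The eighth power turns the square root into an honest fourth power and removes the power of -i,
so no branch of the root remains. -/
theorem inversionFactor_pow (τ : ℂ) : τ ^ 4 * inversionFactor τ ^ 8 = 1 ∨ τ = 0 := by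
  by_cases h : τ = 0
  · exact Or.inr h
  left
  have h0 : -Complex.I * τ ≠ 0 := mul_ne_zero (neg_ne_zero.mpr Complex.I_ne_zero) h
  have h1 : ((-Complex.I * τ) ^ (1 / 2 : ℂ)) ^ 8 = τ ^ 4 := by
    rw [← Complex.cpow_nat_mul, show ((8 : ℕ) : ℂ) * (1 / 2) = (4 : ℕ) by norm_num,
      Complex.cpow_natCast, mul_pow, neg_pow, Complex.I_pow_four]
    norm_num
  rw [inversionFactor, div_pow, h1, one_pow]
  field_simp

theorem theta3_eq_inv (τ : ℂ) : theta3 τ = inversionFactor τ * theta3 (-1 / τ) := by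
  rw [theta3, jacobiTheta₂_functional_equation, theta3, inversionFactor]
  simp

theorem theta4_eq_inv (h : τ ≠ 0) : theta4 τ = inversionFactor τ * theta2 (-1 / τ) := by
  rw [theta4, jacobiTheta₂_functional_equation, theta2, inversionFactor,
    ← jacobiTheta₂_neg_left (1 / 2 / τ), mul_assoc]
  congr 2
  · congr 1
    field_simp
    ring
  · congr 1
    field_simp

theorem theta2_eq_inv (h : τ ≠ 0) : theta2 τ = inversionFactor τ * theta4 (-1 / τ) := by
  have e : Complex.exp (Real.pi * Complex.I * τ / 4) *
      Complex.exp (-Real.pi * Complex.I * (τ / 2) ^ 2 / τ) = 1 := by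
    rw [← Complex.exp_add, Complex.exp_eq_one_iff]
    exact ⟨0, by field_simp; ring⟩
  rw [theta2, jacobiTheta₂_functional_equation, theta4, inversionFactor,
    show τ / 2 / τ = 1 / 2 by field_simp]
  linear_combination 1 / (-Complex.I * τ) ^ (1 / 2 : ℂ) * jacobiTheta₂ (1 / 2) (-1 / τ) * e

theorem theta3_inv_pow (h : τ ≠ 0) : theta3 (-1 / τ) ^ 8 = τ ^ 4 * theta3 τ ^ 8 := by
  rw [theta3_eq_inv τ]
  linear_combination -theta3 (-1 / τ) ^ 8 * (inversionFactor_pow τ).resolve_right h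

theorem theta2_inv_pow (h : τ ≠ 0) : theta2 (-1 / τ) ^ 8 = τ ^ 4 * theta4 τ ^ 8 := by
  rw [theta4_eq_inv h]
  linear_combination -theta2 (-1 / τ) ^ 8 * (inversionFactor_pow τ).resolve_right h

theorem theta4_inv_pow (h : τ ≠ 0) : theta4 (-1 / τ) ^ 8 = τ ^ 4 * theta2 τ ^ 8 := by
  rw [theta2_eq_inv h]
  linear_combination -theta4 (-1 / τ) ^ 8 * (inversionFactor_pow τ).resolve_right h

theorem differentiableAt_theta3 (hτ : 0 < τ.im) : DifferentiableAt ℂ theta3 τ :=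
  differentiableAt_jacobiTheta₂_snd 0 hτ

theorem differentiableAt_theta4 (hτ : 0 < τ.im) : DifferentiableAt ℂ theta4 τ :=
  differentiableAt_jacobiTheta₂_snd (1 / 2) hτ

theorem differentiableAt_theta2 (hτ : 0 < τ.im) : DifferentiableAt ℂ theta2 τ := by
  have h := (hasFDerivAt_jacobiTheta₂ (τ / 2) hτ).differentiableAt
  have h' : DifferentiableAt ℂ (fun τ : ℂ => jacobiTheta₂ (τ / 2) τ) τ :=
    DifferentiableAt.comp (f := fun τ : ℂ => (τ / 2, τ)) τ h (by fun_prop)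
  unfold theta2
  exact DifferentiableAt.mul (by fun_prop) h'

open Filter Topology

theorem tendsto_im_atImInfty : Tendsto (fun τ : ℍ => τ.im) atImInfty atTop := tendsto_comap

theorem tendsto_theta3 : Tendsto (fun τ : ℍ => theta3 τ) atImInfty (𝓝 1) := by
  have h1 : Tendsto (fun τ : ℂ => jacobiTheta τ - 1) (comap Complex.im atTop) (𝓝 0) := by
    refine isBigO_at_im_infty_jacobiTheta_sub_one.trans_tendsto ?_
    exact Real.tendsto_exp_atBot.comp
      ((tendsto_comap (f := Complex.im)).const_mul_atTop_of_neg (neg_neg_of_pos Real.pi_pos))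
  have h2 := (h1.comp (tendsto_comap_iff.mpr tendsto_im_atImInfty :
    Tendsto (fun τ : ℍ => (τ : ℂ)) atImInfty _)).add_const 1
  simpa [Function.comp_def, jacobiTheta_eq_jacobiTheta₂, theta3] using h2

theorem tendsto_theta4 : Tendsto (fun τ : ℍ => theta4 τ) atImInfty (𝓝 1) := by
  have h : Tendsto (fun τ : ℍ => (1 : ℝ) +ᵥ τ) atImInfty atImInfty := by
    rw [atImInfty, tendsto_comap_iff]
    simpa [Function.comp_def] using! tendsto_im_atImInfty
  refine (tendsto_theta3.comp h).congr fun τ => ?_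
  simp [← theta3_add_one, add_comm]

/-- The exponent 2n² + n is nonnegative on integers and zero only at n = 0. This limit supplies the
leading coefficient of θ₂⁸ = 256 q ψ(q)⁸, which fixes the constant in the formula for Δ. -/
theorem tendsto_psi :
    Tendsto (fun τ : ℍ => jacobiTheta₂ τ (4 * τ)) atImInfty (𝓝 1) := by
  have key : ∀ (n : ℤ) (τ : ℍ), ‖jacobiTheta₂_term n τ (4 * τ)‖ =
      Real.exp (-(Real.pi * (2 * n * (2 * n + 1))) * τ.im) := fun n τ => by
    rw [norm_jacobiTheta₂_term]
    simp
    ring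
  have hn : ∀ n : ℤ, (0 : ℝ) ≤ 2 * n * (2 * n + 1) := fun n => by
    have : (0 : ℤ) ≤ 2 * n * (2 * n + 1) := by
      rcases le_or_gt 0 n with h | h
      · positivity
      · nlinarith
    exact_mod_cast this
  -- The terms at τ = i dominate those at every τ with imaginary part at least 1.
  have hsum := (hasSum_jacobiTheta₂_term I (four_mul_im_pos I.im_pos)).summable.norm
  have h1 : (1 : ℂ) = ∑' n : ℤ, if n = 0 then 1 else 0 := by rw [tsum_ite_eq]
  rw [h1]
  refine tendsto_tsum_of_dominated_convergence hsum (fun n => ?_) ?_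
  · split_ifs with h
    · subst h
      simp [jacobiTheta₂_term]
    · rw [tendsto_zero_iff_norm_tendsto_zero]
      simp only [key]
      refine Real.tendsto_exp_atBot.comp (tendsto_im_atImInfty.const_mul_atTop_of_neg ?_)
      have : (2 * n * (2 * n + 1) : ℝ) ≠ 0 := by
        have : 2 * n * (2 * n + 1) ≠ 0 := by
          refine mul_ne_zero (by omega) (by omega)
        exact_mod_cast this
      have := lt_of_le_of_ne (hn n) this.symm
      have := Real.pi_pos
      nlinarith [mul_pos Real.pi_pos ‹0 < (2 * n * (2 * n + 1) : ℝ)›]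
  · filter_upwards [tendsto_im_atImInfty.eventually_ge_atTop 1] with τ hτ n
    rw [key, key, Real.exp_le_exp]
    have h2 := mul_nonneg Real.pi_pos.le (hn n)
    simp only [I_im]
    nlinarith

theorem theta2_pow_eight (hτ : 0 < τ.im) :
    theta2 τ ^ 8 = 256 * Complex.exp (2 * Real.pi * Complex.I * τ) *
      jacobiTheta₂ τ (4 * τ) ^ 8 := by
  rw [theta2_eq_psi hτ, mul_pow, mul_pow, ← Complex.exp_nat_mul]
  ring_nf

theorem tendsto_qParam : Tendsto (fun τ : ℍ => Complex.exp (2 * Real.pi * Complex.I * τ))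
    atImInfty (𝓝 0) := by
  simpa [Function.Periodic.qParam] using qParam_tendsto_atImInfty one_pos

theorem tendsto_theta2_pow : Tendsto (fun τ : ℍ => theta2 τ ^ 8) atImInfty (𝓝 0) := by
  have h := (tendsto_qParam.const_mul 256).mul (tendsto_psi.pow 8)
  simp only [mul_zero, zero_mul] at h
  exact h.congr fun τ => (theta2_pow_eight τ.im_pos).symm

end JacobiTheta

/-! ### E₄, Δ and j in terms of theta constants -/

namespace JacobiTheta

open Filter Topology ModularForm MatrixGroups Manifold

/-- The sum of the eighth powers of the theta constants. -/
noncomputable def thetaSum (τ : ℂ) : ℂ := theta2 τ ^ 8 + theta3 τ ^ 8 + theta4 τ ^ 8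

/-- The product of the eighth powers of the theta constants. -/
noncomputable def thetaProd (τ : ℂ) : ℂ := theta2 τ ^ 8 * theta3 τ ^ 8 * theta4 τ ^ 8

theorem slash_T_eq {f : ℂ → ℂ} (k : ℤ) (h : ∀ τ : ℍ, f (τ + 1) = f τ) :
    (fun τ : ℍ => f τ) ∣[k] ModularGroup.T = fun τ : ℍ => f τ := by
  ext τ
  have hd : denom ModularGroup.T τ = 1 := by
    rw [ModularGroup.denom_apply]
    simp [ModularGroup.coe_T]
  rw [SL_slash_apply, hd, modular_T_smul]
  simp [← h τ, add_comm]

theorem slash_S_eq {f : ℂ → ℂ} (k : ℤ) (h : ∀ τ : ℍ, f (-1 / τ) = (τ : ℂ) ^ k * f τ) :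
    (fun τ : ℍ => f τ) ∣[k] ModularGroup.S = fun τ : ℍ => f τ := by
  ext τ
  have h0 := zpow_ne_zero k τ.ne_zero
  have e : (((ModularGroup.S • τ : ℍ)) : ℂ) = -1 / τ := by
    rw [modular_S_smul, neg_div, one_div, ← inv_neg]
  rw [SL_slash_apply, ModularGroup.denom_S, e, h, mul_right_comm, ← zpow_add₀ τ.ne_zero]
  simp

theorem mdifferentiable_of_differentiableAt {f : ℂ → ℂ}
    (h : ∀ τ : ℂ, 0 < τ.im → DifferentiableAt ℂ f τ) : MDiff (fun τ : ℍ => f τ) := by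
  rw [UpperHalfPlane.mdifferentiable_iff]
  refine DifferentiableOn.congr (f := f) (fun z hz => (h z hz).differentiableWithinAt)
    fun z hz => ?_
  simp [ofComplex_apply_of_im_pos hz]

/-- Translation exchanges θ₃⁸ and θ₄⁸, inversion exchanges θ₂⁸ and θ₄⁸ up to τ⁴; symmetric functions
of the three are therefore modular for the full group. -/
theorem thetaSum_add_one (τ : ℂ) : thetaSum (τ + 1) = thetaSum τ := by
  simp only [thetaSum, theta2_add_one_pow, theta3_add_one, theta4_add_one]
  ring

theorem thetaProd_add_one (τ : ℂ) : thetaProd (τ + 1) = thetaProd τ := by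
  simp only [thetaProd, theta2_add_one_pow, theta3_add_one, theta4_add_one]
  ring

theorem thetaSum_inv {τ : ℂ} (h : τ ≠ 0) : thetaSum (-1 / τ) = τ ^ (4 : ℤ) * thetaSum τ := by
  rw [thetaSum, theta2_inv_pow h, theta3_inv_pow h, theta4_inv_pow h, thetaSum]
  norm_cast
  ring

theorem thetaProd_inv {τ : ℂ} (h : τ ≠ 0) : thetaProd (-1 / τ) = τ ^ (12 : ℤ) * thetaProd τ := by
  rw [thetaProd, theta2_inv_pow h, theta3_inv_pow h, theta4_inv_pow h, thetaProd]
  norm_cast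
  ring

theorem tendsto_thetaSum : Tendsto (fun τ : ℍ => thetaSum τ) atImInfty (𝓝 2) := by
  have := (tendsto_theta2_pow.add (tendsto_theta3.pow 8)).add (tendsto_theta4.pow 8)
  norm_num at this
  exact this

theorem tendsto_thetaProd : Tendsto (fun τ : ℍ => thetaProd τ) atImInfty (𝓝 0) := by
  simpa [thetaProd] using (tendsto_theta2_pow.mul (tendsto_theta3.pow 8)).mul (tendsto_theta4.pow 8)

theorem differentiableAt_thetaSum (τ : ℂ) (hτ : 0 < τ.im) : DifferentiableAt ℂ thetaSum τ :=
  (((differentiableAt_theta2 hτ).pow 8).add ((differentiableAt_theta3 hτ).pow 8)).add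
    ((differentiableAt_theta4 hτ).pow 8)

theorem differentiableAt_thetaProd (τ : ℂ) (hτ : 0 < τ.im) : DifferentiableAt ℂ thetaProd τ :=
  (((differentiableAt_theta2 hτ).pow 8).mul ((differentiableAt_theta3 hτ).pow 8)).mul
    ((differentiableAt_theta4 hτ).pow 8)

theorem thetaSum_slash (γ : SL(2, ℤ)) :
    (fun τ : ℍ => thetaSum τ) ∣[(4 : ℤ)] γ = fun τ : ℍ => thetaSum τ :=
  SlashInvariantForm.slash_action_generators_SL2Z
    (slash_S_eq _ fun τ => thetaSum_inv τ.ne_zero) (slash_T_eq _ fun τ => thetaSum_add_one τ) γ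

theorem thetaProd_slash (γ : SL(2, ℤ)) :
    (fun τ : ℍ => thetaProd τ) ∣[(12 : ℤ)] γ = fun τ : ℍ => thetaProd τ :=
  SlashInvariantForm.slash_action_generators_SL2Z
    (slash_S_eq _ fun τ => thetaProd_inv τ.ne_zero) (slash_T_eq _ fun τ => thetaProd_add_one τ) γ

/-- The sum of the eighth powers of the theta constants as a modular form. -/
noncomputable def thetaSumForm : ModularForm 𝒮ℒ 4 where
  toFun τ := thetaSum τ
  slash_action_eq' A hA := by
    obtain ⟨A, rfl⟩ := hA
    exact thetaSum_slash A
  holo' := mdifferentiable_of_differentiableAt differentiableAt_thetaSum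
  bdd_at_cusps' hc := by
    -- By slash invariance, the growth condition at every cusp reduces to the limit at i∞.
    rw [Subgroup.IsArithmetic.isCusp_iff_isCusp_SL2Z] at hc
    rw [OnePoint.isBoundedAt_iff_forall_SL2Z hc]
    intro γ _
    rw [thetaSum_slash]
    exact tendsto_thetaSum.isBigO_one ℝ

/-- The product of the eighth powers of the theta constants as a cusp form. -/
noncomputable def thetaProdForm : CuspForm 𝒮ℒ 12 where
  toFun τ := thetaProd τ
  slash_action_eq' A hA := by
    obtain ⟨A, rfl⟩ := hA
    exact thetaProd_slash A
  holo' := mdifferentiable_of_differentiableAt differentiableAt_thetaProd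
  zero_at_cusps' hc := by
    rw [Subgroup.IsArithmetic.isCusp_iff_isCusp_SL2Z] at hc
    rw [OnePoint.isZeroAt_iff_forall_SL2Z hc]
    intro γ _
    rw [thetaProd_slash]
    exact tendsto_thetaProd

/-- The space of weight 4 forms is a line, so comparing constant terms suffices. -/
theorem E₄_eq_thetaSum (τ : ℍ) : 2 * E₄ τ = thetaSum τ := by
  have hE : E₄ ≠ 0 := EisensteinSeries.E_ne_zero (by norm_num) ⟨2, rfl⟩
  obtain ⟨c, hc⟩ := (finrank_eq_one_iff_of_nonzero' _ hE).mp
    (Module.rank_eq_one_iff_finrank_eq_one.mp levelOne_weight_four_rank_one) thetaSumForm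
  have h0 : (qExpansion 1 thetaSumForm).coeff 0 = 2 := by
    rw [qExpansion_coeff_zero one_pos
      (ModularFormClass.analyticAt_cuspFunction_zero _ one_pos one_mem_strictPeriods_SL)
      (SlashInvariantFormClass.periodic_comp_ofComplex _ one_mem_strictPeriods_SL)]
    exact tendsto_thetaSum.limUnder_eq
  have h1 : (qExpansion 1 E₄).coeff 0 = 1 :=
    EisensteinSeries.E_qExpansion_coeff_zero (by norm_num) ⟨2, rfl⟩
  have h2 : c = 2 := by
    rw [← hc, FunLike.coe_smul, ModularForm.qExpansion_smul one_pos one_mem_strictPeriods_SL,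
      PowerSeries.coeff_smul, h1] at h0
    simpa using h0
  have := congrArg (fun f : ModularForm 𝒮ℒ 4 => f τ) hc
  rw [h2] at this
  exact this

/-- Weight 12 cusp forms are multiples of Δ; the multiple is read off by dividing both sides by q
and letting τ tend to i∞. -/
theorem discriminant_eq_thetaProd (τ : ℍ) : 256 * discriminant τ = thetaProd τ := by
  obtain ⟨c, hc⟩ := CuspForm.exists_smul_discriminant_of_weight_eq_twelve thetaProdForm
  have hc' : ∀ τ : ℍ, c * discriminant τ = thetaProd τ := fun τ =>
    congrArg (fun f : CuspForm 𝒮ℒ 12 => f τ) hc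
  have h1 : Tendsto (fun τ : ℍ => c * ∏' n, (1 - eta_q n τ) ^ 24) atImInfty (𝓝 (c * 1)) :=
    tendsto_atImInfty_tprod_one_sub_eta_q_pow.const_mul c
  have h2 : Tendsto (fun τ : ℍ => 256 * jacobiTheta₂ τ (4 * τ) ^ 8 * theta3 τ ^ 8 * theta4 τ ^ 8)
      atImInfty (𝓝 256) := by
    simpa using (((tendsto_psi.pow 8).const_mul 256).mul
      (tendsto_theta3.pow 8)).mul (tendsto_theta4.pow 8)
  have h3 : c = 256 := by
    rw [mul_one] at h1
    refine tendsto_nhds_unique (h1.congr fun τ => ?_) h2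
    have h := hc' τ
    rw [discriminant_eq_q_prod, thetaProd, theta2_pow_eight τ.im_pos] at h
    have hq : Function.Periodic.qParam 1 τ = Complex.exp (2 * Real.pi * Complex.I * τ) := by
      simp [Function.Periodic.qParam]
    rw [hq] at h
    refine mul_left_cancel₀ (Complex.exp_ne_zero (2 * Real.pi * Complex.I * τ)) ?_
    linear_combination h
  rw [← h3, hc']

theorem thetaProd_ne_zero {τ : ℂ} (hτ : 0 < τ.im) : thetaProd τ ≠ 0 := by
  have := discriminant_eq_thetaProd ⟨τ, hτ⟩
  rw [← this]
  exact mul_ne_zero (by norm_num) (discriminant_ne_zero _)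

theorem theta2_ne_zero {τ : ℂ} (hτ : 0 < τ.im) : theta2 τ ≠ 0 := fun h =>
  thetaProd_ne_zero hτ (by simp [thetaProd, h])

theorem theta3_ne_zero {τ : ℂ} (hτ : 0 < τ.im) : theta3 τ ≠ 0 := fun h =>
  thetaProd_ne_zero hτ (by simp [thetaProd, h])

theorem theta4_ne_zero {τ : ℂ} (hτ : 0 < τ.im) : theta4 τ ≠ 0 := fun h =>
  thetaProd_ne_zero hτ (by simp [thetaProd, h])

theorem kleinJ_eq (τ : ℍ) :
    OctavicCF.kleinJ τ = 32 * thetaSum τ ^ 3 / thetaProd τ := by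
  rw [OctavicCF.kleinJ, ← E₄_eq_thetaSum, ← discriminant_eq_thetaProd]
  have := discriminant_ne_zero τ
  field_simp
  ring

theorem kleinJ_fricke (τ : ℍ) :
    OctavicCF.kleinJ (OctavicCF.fricke τ) = 32 * thetaSum (8 * τ) ^ 3 / thetaProd (8 * τ) := by
  have h0 : (8 * τ : ℂ) ≠ 0 := mul_ne_zero (by norm_num) τ.ne_zero
  have e : (OctavicCF.fricke τ : ℂ) = -1 / (8 * τ) := rfl
  rw [kleinJ_eq, e, thetaSum_inv h0, thetaProd_inv h0]
  have h1 := thetaProd_ne_zero (eight_mul_im_pos τ.im_pos)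
  have h2 := pow_ne_zero 12 h0
  norm_cast at h1 h2 ⊢
  rw [div_eq_div_iff (mul_ne_zero h2 h1) h1]
  ring

end JacobiTheta

/-! ### Jacobi triple product -/

namespace JacobiTheta

open Filter Topology

/-- The finite Euler product `(p²; p²)_N`. -/
noncomputable def eulerProd (p : ℂ) (N : ℕ) : ℂ := ∏ i ∈ Finset.range N, (1 - p ^ (2 * (i + 1)))

/-- The reciprocal of `(p²; p²)_n`, extended by zero to negative `n`. -/
noncomputable def eulerRecip (p : ℂ) : ℤ → ℂ
  | Int.ofNat n => (eulerProd p n)⁻¹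
  | Int.negSucc _ => 0

theorem eulerProd_succ (p : ℂ) (N : ℕ) :
    eulerProd p (N + 1) = eulerProd p N * (1 - p ^ (2 * (N + 1))) :=
  Finset.prod_range_succ _ _

theorem one_sub_pow_ne_zero {p : ℂ} (hp : ‖p‖ < 1) {n : ℕ} (hn : n ≠ 0) : 1 - p ^ n ≠ 0 := by
  intro h
  have := congrArg norm (sub_eq_zero.mp h)
  rw [norm_one, norm_pow] at this
  exact (pow_lt_one₀ (norm_nonneg p) hp hn).ne this.symm

theorem eulerProd_ne_zero {p : ℂ} (hp : ‖p‖ < 1) (N : ℕ) : eulerProd p N ≠ 0 :=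
  Finset.prod_ne_zero_iff.mpr fun i _ => one_sub_pow_ne_zero hp (by omega)

theorem eulerRecip_natCast (p : ℂ) (n : ℕ) : eulerRecip p n = (eulerProd p n)⁻¹ := rfl

theorem eulerRecip_of_neg (p : ℂ) {n : ℤ} (hn : n < 0) : eulerRecip p n = 0 := by
  cases n with
  | ofNat n => exact absurd hn (by simp)
  | negSucc n => rfl

/-- Extension by zero is consistent with the recursion at n = 0, where 1 - p⁰ vanishes, so later
computations need no boundary cases. -/
theorem eulerRecip_pred {p : ℂ} (hp : ‖p‖ < 1) (n : ℤ) :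
    eulerRecip p (n - 1) = (1 - p ^ (2 * n)) * eulerRecip p n := by
  rcases lt_trichotomy n 0 with h | h | h
  · rw [eulerRecip_of_neg p h, eulerRecip_of_neg p (by omega), mul_zero]
  · subst h
    rw [eulerRecip_of_neg p (by omega)]
    simp
  · obtain ⟨m, rfl⟩ : ∃ m : ℕ, n = ((m + 1 : ℕ) : ℤ) := ⟨(n - 1).toNat, by omega⟩
    rw [show ((m + 1 : ℕ) : ℤ) - 1 = (m : ℕ) by push_cast; ring, eulerRecip_natCast,
      eulerRecip_natCast, eulerProd_succ,
      show (2 * ((m + 1 : ℕ) : ℤ)) = ((2 * (m + 1) : ℕ) : ℤ) by push_cast; ring, zpow_natCast]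
    have h1 := eulerProd_ne_zero hp m
    have h2 := one_sub_pow_ne_zero hp (n := 2 * (m + 1)) (by omega)
    field_simp

/-- The coefficients in the finite form of the Jacobi triple product. -/
noncomputable def tripleCoeff (p : ℂ) (N : ℕ) (n : ℤ) : ℂ :=
  eulerProd p (2 * N) * (eulerRecip p (N + n) * eulerRecip p (N - n))

/-- Coefficient of zⁿ after multiplication by (1 + p^(2N+1) z)(1 + p^(2N+1) z⁻¹) = 1 + p^(4N+2) +
p^(2N+1)(z + z⁻¹). -/
theorem tripleCoeff_succ {p : ℂ} (hp : ‖p‖ < 1) (hp0 : p ≠ 0) (N : ℕ) (n : ℤ) :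
    tripleCoeff p (N + 1) n * p ^ (n ^ 2) =
      (1 + p ^ (4 * N + 2)) * (tripleCoeff p N n * p ^ (n ^ 2)) +
        p ^ (2 * N + 1) * (tripleCoeff p N (n - 1) * p ^ ((n - 1) ^ 2)) +
        p ^ (2 * N + 1) * (tripleCoeff p N (n + 1) * p ^ ((n + 1) ^ 2)) := by
  set X : ℂ := p ^ (2 * (N + 1 + n)) with hX
  set Y : ℂ := p ^ (2 * (N + 1 - n)) with hY
  have w0 : p ^ 2 ≠ 0 := pow_ne_zero 2 hp0
  have hXY : X * Y = p ^ (4 * N + 4) := by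
    rw [hX, hY, ← zpow_add₀ hp0, ← zpow_natCast]
    congr 1
    push_cast
    ring
  have hX' : p ^ (2 * (N + n) : ℤ) * p ^ 2 = X := by
    rw [hX, ← zpow_natCast, ← zpow_add₀ hp0]
    congr 1
    push_cast
    ring
  have hY' : p ^ (2 * (N - n) : ℤ) * p ^ 2 = Y := by
    rw [hY, ← zpow_natCast, ← zpow_add₀ hp0]
    congr 1
    push_cast
    ring
  have r1 := eulerRecip_pred hp (N + 1 + n)
  have r2 := eulerRecip_pred hp (N + n)
  have s1 := eulerRecip_pred hp (N + 1 - n)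
  have s2 := eulerRecip_pred hp (N - n)
  rw [show (N + 1 + n - 1 : ℤ) = N + n by ring, ← hX] at r1
  rw [show (N + 1 - n - 1 : ℤ) = N - n by ring, ← hY] at s1
  have e1 : p ^ (2 * N + 1) * p ^ ((n - 1) ^ 2) = Y * p ^ (n ^ 2) := by
    rw [hY, ← zpow_natCast, ← zpow_add₀ hp0, ← zpow_add₀ hp0]
    congr 1
    push_cast
    ring
  have e2 : p ^ (2 * N + 1) * p ^ ((n + 1) ^ 2) = X * p ^ (n ^ 2) := by
    rw [hX, ← zpow_natCast, ← zpow_add₀ hp0, ← zpow_add₀ hp0]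
    congr 1
    push_cast
    ring
  have hE : eulerProd p (2 * (N + 1)) =
      eulerProd p (2 * N) * (1 - p ^ (4 * N + 2)) * (1 - p ^ (4 * N + 4)) := by
    rw [show 2 * (N + 1) = 2 * N + 1 + 1 by ring, eulerProd_succ, eulerProd_succ]
    ring_nf
  have c0 : tripleCoeff p (N + 1) n = eulerProd p (2 * N) * (1 - p ^ (4 * N + 2)) *
      (1 - p ^ (4 * N + 4)) * (eulerRecip p (N + 1 + n) * eulerRecip p (N + 1 - n)) := by
    rw [tripleCoeff, hE]
    push_cast
    rfl
  have c1 : tripleCoeff p N n = eulerProd p (2 * N) * ((1 - X) * eulerRecip p (N + 1 + n) *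
      ((1 - Y) * eulerRecip p (N + 1 - n))) := by
    rw [tripleCoeff, r1, s1]
  have c2 : tripleCoeff p N (n - 1) = eulerProd p (2 * N) * ((1 - p ^ (2 * (N + n) : ℤ)) *
      ((1 - X) * eulerRecip p (N + 1 + n)) * eulerRecip p (N + 1 - n)) := by
    rw [tripleCoeff, show (N + (n - 1) : ℤ) = N + n - 1 by ring,
      show (N - (n - 1) : ℤ) = N + 1 - n by ring, r2, r1]
  have c3 : tripleCoeff p N (n + 1) = eulerProd p (2 * N) * (eulerRecip p (N + 1 + n) *
      ((1 - p ^ (2 * (N - n) : ℤ)) * ((1 - Y) * eulerRecip p (N + 1 - n)))) := by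
    rw [tripleCoeff, show (N - (n + 1) : ℤ) = N - n - 1 by ring,
      show (N + (n + 1) : ℤ) = N + 1 + n by ring, s2, s1]
  have hW : p ^ (4 * N + 2) * p ^ 2 = X * Y := by rw [hXY]; ring
  have key : (1 - p ^ (4 * N + 2)) * (1 - p ^ (4 * N + 4)) =
      (1 + p ^ (4 * N + 2)) * ((1 - X) * (1 - Y)) +
        Y * ((1 - p ^ (2 * (N + n) : ℤ)) * (1 - X)) +
        X * ((1 - p ^ (2 * (N - n) : ℤ)) * (1 - Y)) := by
    rw [← hXY]
    generalize p ^ (4 * N + 2) = W at *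
    generalize p ^ (2 * (N + n) : ℤ) = U at *
    generalize p ^ (2 * (N - n) : ℤ) = V at *
    -- Multiplying by p² makes everything polynomial in X and Y, since W p² = XY, U p² = X and V p²
    -- = Y.
    refine mul_right_cancel₀ w0 ?_
    linear_combination (-(1 - X * Y) - (1 - X) * (1 - Y)) * hW + Y * (1 - X) * hX' +
      X * (1 - Y) * hY'
  rw [c0, c1, c2, c3]
  linear_combination eulerProd p (2 * N) * eulerRecip p (N + 1 + n) *
    eulerRecip p (N + 1 - n) * p ^ (n ^ 2) * key -
    eulerProd p (2 * N) * ((1 - p ^ (2 * (N + n) : ℤ)) *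
      ((1 - X) * eulerRecip p (N + 1 + n)) * eulerRecip p (N + 1 - n)) * e1 -
    eulerProd p (2 * N) * (eulerRecip p (N + 1 + n) *
      ((1 - p ^ (2 * (N - n) : ℤ)) * ((1 - Y) * eulerRecip p (N + 1 - n)))) * e2

/-- The finite form of the Jacobi triple product. -/
theorem hasSum_tripleCoeff {p z : ℂ} (hp : ‖p‖ < 1) (hp0 : p ≠ 0) (hz : z ≠ 0) (N : ℕ) :
    HasSum (fun n : ℤ => tripleCoeff p N n * p ^ (n ^ 2) * z ^ n)
      (∏ k ∈ Finset.range N, (1 + p ^ (2 * k + 1) * z) * (1 + p ^ (2 * k + 1) * z⁻¹)) := by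
  induction N with
  | zero =>
    have h : ∀ n : ℤ, n ≠ 0 → tripleCoeff p 0 n * p ^ (n ^ 2) * z ^ n = 0 := fun n hn => by
      rcases lt_or_gt_of_ne hn with h | h
      · simp [tripleCoeff, eulerRecip_of_neg p h]
      · simp [tripleCoeff, eulerRecip_of_neg p (neg_neg_of_pos h)]
    convert hasSum_single (f := fun n : ℤ => tripleCoeff p 0 n * p ^ (n ^ 2) * z ^ n) 0 h using 1
    have := eulerRecip_natCast p 0
    simp only [Nat.cast_zero] at this
    simp [tripleCoeff, this, eulerProd]
  | succ N ih =>
    -- Index shifts by one implement multiplication by z and z⁻¹.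
    have h1 := (Equiv.subRight (1 : ℤ)).hasSum_iff.mpr ih
    have h2 := (Equiv.addRight (1 : ℤ)).hasSum_iff.mpr ih
    rw [Finset.prod_range_succ]
    have h := ((ih.mul_left (1 + p ^ (4 * N + 2))).add
      (h1.mul_left (p ^ (2 * N + 1) * z))).add (h2.mul_left (p ^ (2 * N + 1) * z⁻¹))
    have hval (P : ℂ) : P * ((1 + p ^ (2 * N + 1) * z) * (1 + p ^ (2 * N + 1) * z⁻¹)) =
        (1 + p ^ (4 * N + 2)) * P + p ^ (2 * N + 1) * z * P + p ^ (2 * N + 1) * z⁻¹ * P := by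
      field_simp
      ring
    rw [hval]
    refine h.congr_fun fun n => ?_
    rw [tripleCoeff_succ hp hp0]
    simp only [Function.comp_apply, Equiv.subRight_apply, Equiv.coe_addRight]
    rw [zpow_sub_one₀ hz, zpow_add_one₀ hz]
    field_simp

theorem exists_tendsto_eulerProd {p : ℂ} (hp : ‖p‖ < 1) :
    ∃ E : ℂ, E ≠ 0 ∧ Tendsto (eulerProd p) atTop (𝓝 E) := by
  have hs : Summable fun i : ℕ => ‖-p ^ (2 * (i + 1))‖ := by
    have h := (summable_geometric_of_lt_one (sq_nonneg ‖p‖)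
      (pow_lt_one₀ (norm_nonneg p) hp two_ne_zero)).mul_left (‖p‖ ^ 2)
    refine h.congr fun i => ?_
    rw [norm_neg, norm_pow]
    ring
  refine ⟨∏' i : ℕ, (1 + -p ^ (2 * (i + 1))), ?_, ?_⟩
  · refine tprod_one_add_ne_zero_of_summable (fun i => ?_) hs
    rw [← sub_eq_add_neg]
    exact one_sub_pow_ne_zero hp (by omega)
  · refine (multipliable_one_add_of_summable hs).hasProd.tendsto_prod_nat.congr fun N => ?_
    simp only [eulerProd, sub_eq_add_neg]

theorem tendsto_eulerRecip {p E : ℂ} (hE : E ≠ 0) (h : Tendsto (eulerProd p) atTop (𝓝 E)) :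
    Tendsto (eulerRecip p) atTop (𝓝 E⁻¹) := by
  have h1 : Tendsto (fun n : ℤ => (eulerProd p n.toNat)⁻¹) atTop (𝓝 E⁻¹) :=
    (h.comp (tendsto_atTop_atTop.mpr fun b => ⟨b, fun a h => by omega⟩ :
      Tendsto Int.toNat atTop atTop)).inv₀ hE
  refine h1.congr' ?_
  filter_upwards [eventually_ge_atTop 0] with n hn
  rw [← eulerRecip_natCast, Int.toNat_of_nonneg hn]

theorem exists_norm_eulerRecip_le {p E : ℂ} (hE : E ≠ 0)
    (h : Tendsto (eulerProd p) atTop (𝓝 E)) : ∃ C : ℝ, 0 ≤ C ∧ ∀ n, ‖eulerRecip p n‖ ≤ C := by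
  obtain ⟨C, hC⟩ := (h.inv₀ hE).norm.bddAbove_range
  have hC0 : 0 ≤ C := (norm_nonneg _).trans (hC ⟨0, rfl⟩)
  refine ⟨C, hC0, fun n => ?_⟩
  cases n with
  | ofNat n => exact hC ⟨n, rfl⟩
  | negSucc n => simpa [eulerRecip] using hC0

/-- The Jacobi triple product, up to a factor that does not depend on `z`. -/
theorem exists_tendsto_tripleProd {τ : ℂ} (hτ : 0 < τ.im) :
    ∃ C : ℂ, C ≠ 0 ∧ ∀ z : ℂ, Tendsto (fun N => ∏ k ∈ Finset.range N,
      (1 + Complex.exp (Real.pi * Complex.I * τ) ^ (2 * k + 1) *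
          Complex.exp (2 * Real.pi * Complex.I * z)) *
        (1 + Complex.exp (Real.pi * Complex.I * τ) ^ (2 * k + 1) *
          (Complex.exp (2 * Real.pi * Complex.I * z))⁻¹)) atTop (𝓝 (C * jacobiTheta₂ z τ)) := by
  set p := Complex.exp (Real.pi * Complex.I * τ) with hpdef
  have hp : ‖p‖ < 1 := by
    rw [hpdef, Complex.norm_exp, Real.exp_lt_one_iff]
    simpa using mul_pos Real.pi_pos hτ
  have hp0 : p ≠ 0 := Complex.exp_ne_zero _
  obtain ⟨E, hE, hlim⟩ := exists_tendsto_eulerProd hp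
  -- Each coefficient tends to E·E⁻¹·E⁻¹. Only independence of z matters later, where the constant
  -- cancels.
  refine ⟨E⁻¹, inv_ne_zero hE, fun z => ?_⟩
  obtain ⟨C, hC0, hC⟩ := exists_norm_eulerRecip_le hE hlim
  obtain ⟨D, hD⟩ := hlim.norm.bddAbove_range
  have hterm : ∀ n : ℤ, p ^ (n ^ 2) * Complex.exp (2 * Real.pi * Complex.I * z) ^ n =
      jacobiTheta₂_term n z τ := fun n => by
    rw [jacobiTheta₂_term, hpdef, ← Complex.exp_int_mul, ← Complex.exp_int_mul,
      ← Complex.exp_add]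
    congr 1
    push_cast
    ring
  have hs := (hasSum_jacobiTheta₂_term z hτ).summable
  rw [jacobiTheta₂, ← tsum_mul_left]
  refine Tendsto.congr (f₁ := fun N => ∑' n, tripleCoeff p N n * jacobiTheta₂_term n z τ)
    (fun N => ?_) ?_
  · rw [← (hasSum_tripleCoeff hp hp0 (Complex.exp_ne_zero _) _).tsum_eq]
    exact tsum_congr fun n => by rw [mul_assoc, hterm]
  refine tendsto_tsum_of_dominated_convergence (hs.norm.mul_left (D * (C * C))) (fun n => ?_)
    (Eventually.of_forall fun N n => ?_)
  · refine Tendsto.mul_const _ ?_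
    have h1 : Tendsto (fun N : ℕ => eulerProd p (2 * N)) atTop (𝓝 E) :=
      hlim.comp (tendsto_id.const_mul_atTop' two_pos)
    have h2 : Tendsto (fun N : ℕ => eulerRecip p (N + n)) atTop (𝓝 E⁻¹) :=
      (tendsto_eulerRecip hE hlim).comp
        (tendsto_atTop_add_const_right _ _ tendsto_natCast_atTop_atTop)
    have h3 : Tendsto (fun N : ℕ => eulerRecip p (N - n)) atTop (𝓝 E⁻¹) :=
      (tendsto_eulerRecip hE hlim).comp
        (tendsto_atTop_add_const_right _ (-n) tendsto_natCast_atTop_atTop)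
    have h4 := h1.mul (h2.mul h3)
    rwa [mul_inv_cancel_left₀ hE] at h4
  · rw [norm_mul, tripleCoeff, norm_mul, norm_mul]
    have hD' : ‖eulerProd p (2 * N)‖ ≤ D := hD ⟨2 * N, rfl⟩
    have := hC (N + n)
    have := hC (N - n)
    have hD0 : 0 ≤ D := (norm_nonneg _).trans hD'
    gcongr

end JacobiTheta

/-! ### The product v as a quotient of theta functions -/

namespace JacobiTheta

open Filter Topology

theorem jacobiSym_eight (n : ℕ) (hn : n ≠ 0) :
    jacobiSym 8 n = if n % 2 = 0 then 0 else if n % 8 = 1 ∨ n % 8 = 7 then 1 else -1 := by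
  by_cases h : n % 2 = 0
  · rw [if_pos h, jacobiSym.eq_zero_iff]
    refine ⟨hn, fun hg => ?_⟩
    have h2 : (2 : ℤ) ∣ (Int.gcd 8 n : ℤ) := Int.dvd_coe_gcd (by norm_num) (by omega)
    rw [hg] at h2
    norm_num at h2
  · rw [show (8 : ℤ) = 2 ^ 3 by norm_num, jacobiSym.pow_left,
      jacobiSym.at_two (Nat.odd_iff.mpr (by omega)), ZMod.χ₈_nat_eq_if_mod_eight, if_neg h]
    split_ifs <;> norm_num

/-- The `m`-th factor in the product for the Ramanujan–Göllnitz–Gordon function. -/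
noncomputable def goellnitzFactor (q : ℂ) (m : ℕ) : ℂ :=
  (1 - q ^ (m + 1)) ^ (jacobiSym 8 (m + 1))

theorem goellnitzFactor_of_even (q : ℂ) {m : ℕ} (h : (m + 1) % 2 = 0) :
    goellnitzFactor q m = 1 := by
  have := jacobiSym_eight (m + 1) (by omega)
  rw [if_pos h] at this
  rw [goellnitzFactor, this, zpow_zero]

theorem goellnitzFactor_of_pos (q : ℂ) {m : ℕ} (h : (m + 1) % 8 = 1 ∨ (m + 1) % 8 = 7) :
    goellnitzFactor q m = 1 - q ^ (m + 1) := by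
  have := jacobiSym_eight (m + 1) (by omega)
  rw [if_neg (by omega), if_pos h] at this
  rw [goellnitzFactor, this, zpow_one]

theorem goellnitzFactor_of_neg (q : ℂ) {m : ℕ} (h : (m + 1) % 8 = 3 ∨ (m + 1) % 8 = 5) :
    goellnitzFactor q m = (1 - q ^ (m + 1))⁻¹ := by
  have := jacobiSym_eight (m + 1) (by omega)
  rw [if_neg (by omega), if_neg (by omega)] at this
  rw [goellnitzFactor, this, zpow_neg_one]

/-- Inverted factors differ from 1 by qⁿ/(1 - qⁿ), still geometrically small. Convergence is
essential, as `∏'` defaults to 1 without it. -/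
theorem multipliable_goellnitzFactor {q : ℂ} (hq : ‖q‖ < 1) :
    Multipliable (goellnitzFactor q) := by
  have hs : Summable fun m : ℕ => ‖goellnitzFactor q m - 1‖ := by
    have hpos : 0 < 1 - ‖q‖ := by linarith
    refine Summable.of_nonneg_of_le (fun _ => norm_nonneg _) (fun m => ?_)
      ((summable_geometric_of_lt_one (norm_nonneg q) hq).mul_left ((1 - ‖q‖)⁻¹))
    have hle : ‖q ^ (m + 1)‖ ≤ ‖q‖ ^ m := by
      rw [norm_pow]
      exact pow_le_pow_of_le_one (norm_nonneg q) hq.le (Nat.le_succ m)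
    have h1 : 1 ≤ (1 - ‖q‖)⁻¹ := (one_le_inv₀ hpos).mpr (by linarith [norm_nonneg q])
    have h0 : 0 ≤ ‖q‖ ^ m := by positivity
    by_cases he : (m + 1) % 2 = 0
    · rw [goellnitzFactor_of_even q he]
      simpa using by positivity
    by_cases h8 : (m + 1) % 8 = 1 ∨ (m + 1) % 8 = 7
    · rw [goellnitzFactor_of_pos q h8, sub_sub_cancel_left, norm_neg]
      exact hle.trans (le_mul_of_one_le_left h0 h1)
    · rw [goellnitzFactor_of_neg q (by omega)]
      have hne := one_sub_pow_ne_zero hq (Nat.succ_ne_zero m)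
      have e : (1 - q ^ (m + 1))⁻¹ - 1 = (1 - q ^ (m + 1))⁻¹ * q ^ (m + 1) := by
        field_simp
        ring
      have hlow : 1 - ‖q‖ ≤ ‖1 - q ^ (m + 1)‖ := by
        have h2 := norm_sub_norm_le 1 (q ^ (m + 1))
        have h3 : ‖q ^ (m + 1)‖ ≤ ‖q‖ := by
          rw [norm_pow]
          exact pow_le_of_le_one (norm_nonneg q) hq.le (Nat.succ_ne_zero m)
        rw [norm_one] at h2
        linarith
      rw [e, norm_mul, norm_inv]
      gcongr
  simpa using multipliable_one_add_of_summable hs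

/-- The character has period 8, so each block of eight factors contributes residues 1, 7 upstairs
and 3, 5 downstairs. -/
theorem prod_range_goellnitzFactor {q : ℂ} (hq : ‖q‖ < 1) (N : ℕ) :
    (∏ m ∈ Finset.range (8 * N), goellnitzFactor q m) *
        ∏ k ∈ Finset.range N, (1 - q ^ (8 * k + 5)) * (1 - q ^ (8 * k + 3)) =
      ∏ k ∈ Finset.range N, (1 - q ^ (8 * k + 7)) * (1 - q ^ (8 * k + 1)) := by
  induction N with
  | zero => simp
  | succ N ih =>
    rw [show 8 * (N + 1) = 8 * N + 1 + 1 + 1 + 1 + 1 + 1 + 1 + 1 by ring]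
    simp only [Finset.prod_range_succ]
    rw [← ih, goellnitzFactor_of_pos q (m := 8 * N) (by omega),
      goellnitzFactor_of_even q (m := 8 * N + 1) (by omega),
      goellnitzFactor_of_neg q (m := 8 * N + 1 + 1) (by omega),
      goellnitzFactor_of_even q (m := 8 * N + 1 + 1 + 1) (by omega),
      goellnitzFactor_of_neg q (m := 8 * N + 1 + 1 + 1 + 1) (by omega),
      goellnitzFactor_of_even q (m := 8 * N + 1 + 1 + 1 + 1 + 1) (by omega),
      goellnitzFactor_of_pos q (m := 8 * N + 1 + 1 + 1 + 1 + 1 + 1) (by omega),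
      goellnitzFactor_of_even q (m := 8 * N + 1 + 1 + 1 + 1 + 1 + 1 + 1) (by omega)]
    have h3 := one_sub_pow_ne_zero hq (n := 8 * N + 3) (by omega)
    have h5 := one_sub_pow_ne_zero hq (n := 8 * N + 5) (by omega)
    simp only [add_assoc, Nat.reduceAdd]
    field_simp

theorem exp_pi_mul_eight (τ : ℂ) : Complex.exp (Real.pi * Complex.I * (8 * τ)) =
    Complex.exp (2 * Real.pi * Complex.I * τ) ^ 4 := by
  rw [← Complex.exp_nat_mul]
  ring_nf

theorem exp_two_pi_mul_half_add (k : ℕ) (τ : ℂ) :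
    Complex.exp (2 * Real.pi * Complex.I * (1 / 2 + k * τ)) =
      -Complex.exp (2 * Real.pi * Complex.I * τ) ^ k := by
  rw [← Complex.exp_nat_mul, mul_add, Complex.exp_add,
    show 2 * Real.pi * Complex.I * (1 / 2) = Real.pi * Complex.I by ring, Complex.exp_pi_mul_I]
  ring_nf

/-- The triple product is applied twice with the same period 8τ, hence with the same constant C, and
compared along partial products of length 8N. -/
theorem tprod_goellnitzFactor_mul {τ : ℂ} (hτ : 0 < τ.im) :
    (∏' m, goellnitzFactor (Complex.exp (2 * Real.pi * Complex.I * τ)) m) * goellnitzDen τ =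
      goellnitzNum τ := by
  obtain ⟨C, hC, h⟩ := exists_tendsto_tripleProd (eight_mul_im_pos hτ)
  have hA := h (1 / 2 + τ)
  have hB := h (1 / 2 + 3 * τ)
  have e1 := exp_two_pi_mul_half_add 1 τ
  have e3 := exp_two_pi_mul_half_add 3 τ
  push_cast at e1 e3
  rw [one_mul, pow_one] at e1
  simp only [exp_pi_mul_eight, e1] at hA
  simp only [exp_pi_mul_eight, e3] at hB
  have hq : ‖Complex.exp (2 * Real.pi * Complex.I * τ)‖ < 1 := by
    rw [Complex.norm_exp, Real.exp_lt_one_iff]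
    simpa using mul_pos Real.two_pi_pos hτ
  have hq0 := Complex.exp_ne_zero (2 * Real.pi * Complex.I * τ)
  set q := Complex.exp (2 * Real.pi * Complex.I * τ)
  have hA' : Tendsto (fun N => ∏ k ∈ Finset.range N, (1 - q ^ (8 * k + 5)) *
      (1 - q ^ (8 * k + 3))) atTop (𝓝 (C * goellnitzDen τ)) := by
    refine hA.congr fun N => Finset.prod_congr rfl fun k _ => ?_
    rw [← pow_mul]
    field_simp
    ring
  have hB' : Tendsto (fun N => ∏ k ∈ Finset.range N, (1 - q ^ (8 * k + 7)) *
      (1 - q ^ (8 * k + 1))) atTop (𝓝 (C * goellnitzNum τ)) := by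
    refine hB.congr fun N => Finset.prod_congr rfl fun k _ => ?_
    rw [← pow_mul]
    field_simp
    ring
  have hP := (multipliable_goellnitzFactor hq).hasProd.tendsto_prod_nat.comp
    (tendsto_id.const_mul_atTop' (show 0 < 8 by norm_num) : Tendsto (fun N : ℕ => 8 * N) _ _)
  have := tendsto_nhds_unique ((hP.mul hA').congr fun N => prod_range_goellnitzFactor hq N) hB'
  refine mul_left_cancel₀ hC ?_
  linear_combination this

theorem v_sq_mul (τ : ℍ) : OctavicCF.v τ ^ 2 * goellnitzDen τ ^ 2 =
    Complex.exp (2 * Real.pi * Complex.I * τ) * goellnitzNum τ ^ 2 := by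
  have hv : OctavicCF.v τ = Complex.exp (Real.pi * Complex.I * τ) *
    ∏' m, goellnitzFactor (Complex.exp (2 * Real.pi * Complex.I * τ)) m := rfl
  have he : Complex.exp (Real.pi * Complex.I * τ) ^ 2 =
      Complex.exp (2 * Real.pi * Complex.I * τ) := by
    rw [← Complex.exp_nat_mul]
    ring_nf
  rw [hv, ← tprod_goellnitzFactor_mul τ.im_pos, ← he]
  ring

end JacobiTheta

/-! ### Theta relation for v² and reduction to level 4τ -/

namespace JacobiTheta

variable {τ : ℂ}

theorem psi_ne_zero (hτ : 0 < τ.im) : jacobiTheta₂ τ (4 * τ) ≠ 0 := fun h =>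
  theta2_ne_zero hτ (by rw [theta2_eq_psi hτ, h, mul_zero])

theorem psi_neg_ne_zero (hτ : 0 < τ.im) : jacobiTheta₂ (τ + 1 / 2) (4 * τ) ≠ 0 := by
  have h2 := two_mul_im_pos hτ
  have h := psi_ne_zero h2
  rw [show 4 * (2 * τ) = 8 * τ by ring] at h
  refine (pow_ne_zero_iff two_ne_zero).mp ?_
  rw [psi_neg_sq hτ]
  exact mul_ne_zero (theta4_ne_zero h2) h

/-- The relation between `x = v(τ)²` and theta constants, together with the nonvanishing
statements it entails. -/
theorem v_sq_relation (τ : ℍ) :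
    1 + OctavicCF.v τ ^ 2 ≠ 0 ∧ 1 - OctavicCF.v τ ^ 2 ≠ 0 ∧
      theta2 (4 * τ) ^ 2 * (1 - OctavicCF.v τ ^ 2) ^ 2 =
        4 * OctavicCF.v τ ^ 2 * theta3 (4 * τ) ^ 2 := by
  have hτ := τ.im_pos
  have hx := v_sq_mul τ
  have h4 := four_mul_im_pos hτ
  have hadd := goellnitz_add hτ
  have hsub := goellnitz_sub hτ
  have hrel := goellnitz_add_sq_mul hτ
  have ha := theta3_sq (two_mul_im_pos hτ)
  -- These products equal D²(1 + x) and D²(1 - x), which yields D ≠ 0 and x ≠ ±1 together.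
  have n1 := mul_ne_zero (psi_ne_zero hτ) (theta4_ne_zero h4)
  have n2 := mul_ne_zero (psi_neg_ne_zero hτ) (theta3_ne_zero h4)
  rw [show (2 * (2 * τ) : ℂ) = 4 * τ by ring] at ha
  rw [← hadd] at n1
  rw [← hsub] at n2
  rw [← hx] at n1 n2 hrel
  generalize OctavicCF.v τ ^ 2 = x at *
  have n1' : goellnitzDen τ ^ 2 * (1 + x) ≠ 0 := by convert n1 using 1; ring
  have n2' : goellnitzDen τ ^ 2 * (1 - x) ≠ 0 := by convert n2 using 1; ring
  refine ⟨right_ne_zero_of_mul n1', right_ne_zero_of_mul n2', ?_⟩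
  have hD := pow_ne_zero 2 (left_ne_zero_of_mul n1')
  refine mul_left_cancel₀ hD ?_
  linear_combination -hrel - (goellnitzDen τ ^ 2) ^ 2 * (1 - x) ^ 2 * ha

/-- Two duplications, τ to 2τ to 4τ, under which θ₃(2τ)² becomes a sum and θ₂(2τ)⁴ four times a
product. -/
theorem thetaSum_eq (hτ : 0 < τ.im) :
    thetaSum τ = 2 * ((theta3 (4 * τ) ^ 2 + theta2 (4 * τ) ^ 2) ^ 4 +
      56 * (theta3 (4 * τ) ^ 2 + theta2 (4 * τ) ^ 2) ^ 2 *
        (theta2 (4 * τ) ^ 2 * theta3 (4 * τ) ^ 2) +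
      16 * (theta2 (4 * τ) ^ 2 * theta3 (4 * τ) ^ 2) ^ 2) := by
  have h3 := theta3_sq (two_mul_im_pos hτ)
  have h2 := theta2_sq (two_mul_im_pos hτ)
  rw [show 2 * (2 * τ) = 4 * τ by ring] at h2 h3
  calc thetaSum τ = (theta2 τ ^ 2) ^ 4 + (theta3 τ ^ 2) ^ 4 + (theta4 τ ^ 2) ^ 4 := by
        rw [thetaSum]; ring
    _ = 2 * ((theta3 (2 * τ) ^ 2) ^ 4 +
        14 * (theta3 (2 * τ) ^ 2) ^ 2 * (theta2 (2 * τ) ^ 2) ^ 2 +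
        (theta2 (2 * τ) ^ 2) ^ 4) := by
        rw [theta2_sq hτ, theta3_sq hτ, theta4_sq hτ]; ring
    _ = _ := by rw [h2, h3]; ring

theorem thetaProd_eq (hτ : 0 < τ.im) :
    thetaProd τ = 64 * (theta3 (4 * τ) ^ 2 + theta2 (4 * τ) ^ 2) ^ 2 *
      (theta2 (4 * τ) ^ 2 * theta3 (4 * τ) ^ 2) *
      (theta3 (4 * τ) ^ 2 - theta2 (4 * τ) ^ 2) ^ 8 := by
  have h3 := theta3_sq (two_mul_im_pos hτ)
  have h2 := theta2_sq (two_mul_im_pos hτ)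
  rw [show 2 * (2 * τ) = 4 * τ by ring] at h2 h3
  calc thetaProd τ = (theta2 τ ^ 2) ^ 4 * (theta3 τ ^ 2 * theta4 τ ^ 2) ^ 4 := by
        rw [thetaProd]; ring
    _ = 16 * (theta3 (2 * τ) ^ 2) ^ 2 * (theta2 (2 * τ) ^ 2) ^ 2 *
        ((theta3 (2 * τ) ^ 2) ^ 2 - (theta2 (2 * τ) ^ 2) ^ 2) ^ 4 := by
        rw [theta2_sq hτ, theta3_sq hτ, theta4_sq hτ]; ring
    _ = _ := by rw [h2, h3]; ring

/-- One duplication from 4τ to 8τ, combined with Jacobi's quartic identity at 8τ to remove θ₄. -/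
theorem thetaSum_eight_mul (hτ : 0 < τ.im) :
    8 * thetaSum (8 * τ) = (theta3 (4 * τ) ^ 2) ^ 4 + 14 * (theta3 (4 * τ) ^ 2) ^ 2 *
      ((theta3 (4 * τ) ^ 2) ^ 2 - (theta2 (4 * τ) ^ 2) ^ 2) +
      ((theta3 (4 * τ) ^ 2) ^ 2 - (theta2 (4 * τ) ^ 2) ^ 2) ^ 2 := by
  have h4 := four_mul_im_pos hτ
  have h3 := theta3_sq h4
  have h2 := theta2_sq h4
  have q8 := theta4_pow_four (eight_mul_im_pos hτ)
  rw [show 2 * (4 * τ) = 8 * τ by ring] at h2 h3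
  have e2 : (theta2 (4 * τ) ^ 2) ^ 2 = 4 * theta2 (8 * τ) ^ 2 * theta3 (8 * τ) ^ 2 := by
    rw [h2]; ring
  rw [thetaSum, show theta4 (8 * τ) ^ 8 = (theta4 (8 * τ) ^ 4) ^ 2 by ring, q8, e2, h3]
  ring

theorem thetaProd_eight_mul (hτ : 0 < τ.im) :
    256 * thetaProd (8 * τ) = (theta2 (4 * τ) ^ 2) ^ 8 * (theta3 (4 * τ) ^ 2) ^ 2 *
      ((theta3 (4 * τ) ^ 2) ^ 2 - (theta2 (4 * τ) ^ 2) ^ 2) := by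
  have h4 := four_mul_im_pos hτ
  have h3 := theta3_sq h4
  have h2 := theta2_sq h4
  have q8 := theta4_pow_four (eight_mul_im_pos hτ)
  rw [show 2 * (4 * τ) = 8 * τ by ring] at h2 h3
  have e2 : (theta2 (4 * τ) ^ 2) ^ 2 = 4 * theta2 (8 * τ) ^ 2 * theta3 (8 * τ) ^ 2 := by
    rw [h2]; ring
  rw [thetaProd, show theta4 (8 * τ) ^ 8 = (theta4 (8 * τ) ^ 4) ^ 2 by ring, q8,
    show (theta2 (4 * τ) ^ 2) ^ 8 = ((theta2 (4 * τ) ^ 2) ^ 2) ^ 4 by ring, e2, h3]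
  ring

end JacobiTheta

/-! ### The formulas for j and the involution t -/

namespace OctavicCF

open JacobiTheta

theorem v_sq_ne_zero_and_quadratic_ne_zero (τ : ℍ) :
    v τ ^ 2 ≠ 0 ∧ (v τ ^ 2) ^ 2 - 6 * v τ ^ 2 + 1 ≠ 0 := by
  obtain ⟨-, h1, h⟩ := v_sq_relation τ
  have h4 := four_mul_im_pos τ.im_pos
  have n2 := theta2_ne_zero h4
  have n4 : theta4 (2 * τ) ^ 2 ≠ 0 := pow_ne_zero 2 (theta4_ne_zero (two_mul_im_pos τ.im_pos))
  rw [theta4_sq (two_mul_im_pos τ.im_pos), show (2 * (2 * τ) : ℂ) = 4 * τ by ring] at n4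
  generalize v τ ^ 2 = x at *
  constructor
  · rintro rfl
    simp [n2] at h
  -- The relation gives θ₄(2τ)² (1 - x)² = θ₃(4τ)² (x² - 6x + 1), as θ₄(2τ)² = θ₃(4τ)² - θ₂(4τ)².
  · intro h0
    refine mul_ne_zero n4 (pow_ne_zero 2 h1) ?_
    linear_combination theta3 (4 * τ) ^ 2 * h0 - h

theorem j2Den_v_sq_ne_zero (τ : ℍ) : j2Den (v τ ^ 2) ≠ 0 := by
  obtain ⟨h0, h1, -⟩ := v_sq_relation τ
  obtain ⟨h2, h3⟩ := v_sq_ne_zero_and_quadratic_ne_zero τ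
  rw [← neg_ne_zero, neg_sub] at h1
  rw [add_comm] at h0
  exact mul_ne_zero (mul_ne_zero (mul_ne_zero h2 (pow_ne_zero _ h1)) (pow_ne_zero _ h0))
    (pow_ne_zero _ h3)

theorem j22Den_v_sq_ne_zero (τ : ℍ) : j22Den (v τ ^ 2) ≠ 0 := by
  obtain ⟨h0, h1, -⟩ := v_sq_relation τ
  obtain ⟨h2, h3⟩ := v_sq_ne_zero_and_quadratic_ne_zero τ
  rw [← neg_ne_zero, neg_sub] at h1
  rw [add_comm] at h0
  exact mul_ne_zero (mul_ne_zero (mul_ne_zero (pow_ne_zero _ h2) (pow_ne_zero _ h1))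
    (pow_ne_zero _ h0)) h3

theorem kleinJ_eq_j2 (τ : ℍ) : kleinJ τ = j2 (v τ ^ 2) := by
  have hD := j2Den_v_sq_ne_zero τ
  obtain ⟨-, h1, h⟩ := v_sq_relation τ
  have hT := thetaProd_ne_zero τ.im_pos
  rw [kleinJ_eq, j2, div_eq_div_iff hT hD, thetaSum_eq τ.im_pos, thetaProd_eq τ.im_pos, j2Den]
  generalize v τ ^ 2 = x at *
  generalize theta3 (4 * τ) ^ 2 = P at *
  rw [← eq_div_iff (pow_ne_zero 2 h1)] at h
  have hp : P + theta2 (4 * τ) ^ 2 = P * (1 + x) ^ 2 / (1 - x) ^ 2 := by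
    rw [h]; field_simp; ring
  have hm : P - theta2 (4 * τ) ^ 2 = P * (x ^ 2 - 6 * x + 1) / (1 - x) ^ 2 := by
    rw [h]; field_simp; ring
  have hS : (P + theta2 (4 * τ) ^ 2) ^ 4 + 56 * (P + theta2 (4 * τ) ^ 2) ^ 2 *
      (theta2 (4 * τ) ^ 2 * P) + 16 * (theta2 (4 * τ) ^ 2 * P) ^ 2 =
      P ^ 4 * (x ^ 8 + 232 * x ^ 7 + 732 * x ^ 6 - 1192 * x ^ 5 + 710 * x ^ 4 - 1192 * x ^ 3
        + 732 * x ^ 2 + 232 * x + 1) / (1 - x) ^ 8 := by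
    rw [hp, h]; field_simp; ring
  rw [hS, hp, hm, h]
  -- Making the polynomial factors opaque leaves a monomial identity and avoids expanding the high
  -- powers.
  generalize x ^ 8 + 232 * x ^ 7 + 732 * x ^ 6 - 1192 * x ^ 5 + 710 * x ^ 4 - 1192 * x ^ 3
    + 732 * x ^ 2 + 232 * x + 1 = N
  generalize x ^ 2 - 6 * x + 1 = Q
  rw [show (x - 1) ^ 2 = (1 - x) ^ 2 by ring]
  generalize hy : 1 - x = y at *
  generalize hz : 1 + x = z at *
  rw [show x + 1 = z by rw [← hz, add_comm]]
  field_simp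
  ring

theorem kleinJ_fricke_eq_j22 (τ : ℍ) : kleinJ (fricke τ) = j22 (v τ ^ 2) := by
  have hD := j22Den_v_sq_ne_zero τ
  obtain ⟨-, h1, h⟩ := v_sq_relation τ
  have hT := thetaProd_ne_zero (eight_mul_im_pos τ.im_pos)
  have hs := thetaSum_eight_mul τ.im_pos
  have hp := thetaProd_eight_mul τ.im_pos
  rw [kleinJ_fricke, j22, div_eq_div_iff hT hD, j22Den]
  rw [mul_comm, ← eq_div_iff (by norm_num)] at hs hp
  rw [hs, hp]
  generalize v τ ^ 2 = x at *
  generalize theta3 (4 * τ) ^ 2 = P at *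
  rw [← eq_div_iff (pow_ne_zero 2 h1)] at h
  -- This rests on (1 - x)⁴ - 16x² = (x² - 6x + 1)(1 + x)².
  have hm : P ^ 2 - (theta2 (4 * τ) ^ 2) ^ 2 =
      P ^ 2 * ((1 + x) ^ 2 * (x ^ 2 - 6 * x + 1)) / (1 - x) ^ 4 := by
    rw [h]; field_simp; ring
  have hS : P ^ 4 + 14 * P ^ 2 * (P ^ 2 - (theta2 (4 * τ) ^ 2) ^ 2) +
      (P ^ 2 - (theta2 (4 * τ) ^ 2) ^ 2) ^ 2 =
      16 * P ^ 4 * (x ^ 8 - 8 * x ^ 7 + 12 * x ^ 6 + 8 * x ^ 5 - 10 * x ^ 4 + 8 * x ^ 3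
        + 12 * x ^ 2 - 8 * x + 1) / (1 - x) ^ 8 := by
    rw [hm]; field_simp; ring
  rw [hS, hm, h]
  generalize x ^ 8 - 8 * x ^ 7 + 12 * x ^ 6 + 8 * x ^ 5 - 10 * x ^ 4 + 8 * x ^ 3
    + 12 * x ^ 2 - 8 * x + 1 = N
  generalize x ^ 2 - 6 * x + 1 = Q
  rw [show (x - 1) ^ 4 = (1 - x) ^ 4 by ring]
  generalize hy : 1 - x = y at *
  generalize hz : 1 + x = z at *
  rw [show x + 1 = z by rw [← hz, add_comm]]
  field_simp
  ring

theorem sigma_sq_root : (sigma ^ 2) ^ 2 = 6 * sigma ^ 2 - 1 := by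
  have h : ((Real.sqrt 2 : ℝ) : ℂ) ^ 2 = 2 := by
    rw [← Complex.ofReal_pow, Real.sq_sqrt (by norm_num)]
    norm_num
  rw [sigma]
  linear_combination (((Real.sqrt 2 : ℝ) : ℂ) ^ 2 - 4 * ((Real.sqrt 2 : ℝ) : ℂ) + 2) * h

/-- For w = x - s, y = sx - 1 with s² = 6s - 1, the forms wy, (w - y)², (w + y)², w² - 6wy + y² are
constants times x² - 6x + 1, (x + 1)², (x - 1)², x. -/
theorem j22_eq_j2_comp_t {x : ℂ} (hx : j22Den x ≠ 0) :
    sigma ^ 2 * x - 1 ≠ 0 ∧ j2Den (t x) ≠ 0 ∧ j22 x = j2 (t x) := by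
  have hs := sigma_sq_root
  rw [t]
  generalize sigma ^ 2 = s at *
  have hs0 : s ≠ 0 := by
    rintro rfl
    norm_num at hs
  have hu : (x - s) * (s * x - 1) = s * (x ^ 2 - 6 * x + 1) := by
    linear_combination -x * hs
  have hv : (x - s) ^ 2 + (s * x - 1) ^ 2 = s * (6 * x ^ 2 - 4 * x + 6) := by
    linear_combination (x ^ 2 + 1) * hs
  have hy : s * x - 1 ≠ 0 := by
    intro h
    rw [h, mul_zero] at hu
    have hq := right_ne_zero_of_mul hx
    exact mul_ne_zero hs0 hq hu.symm
  have h1 : (x - s - (s * x - 1)) ^ 2 = 4 * s * (x + 1) ^ 2 := by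
    linear_combination (x + 1) ^ 2 * hs
  have h2 : (x - s + (s * x - 1)) ^ 2 = 8 * s * (x - 1) ^ 2 := by
    linear_combination (x - 1) ^ 2 * hs
  have h3 : (x - s) ^ 2 - 6 * (x - s) * (s * x - 1) + (s * x - 1) ^ 2 = 32 * s * x := by
    linear_combination hv - 6 * hu
  generalize s * x - 1 = y at *
  generalize x - s = w at *
  have hden : j2Den (w / y) = 2 ^ 48 * s ^ 12 * j22Den x / y ^ 24 := by
    have e : j2Den (w / y) = w * y * (w - y) ^ 2 * ((w + y) ^ 2) ^ 2 *
        (w ^ 2 - 6 * w * y + y ^ 2) ^ 8 / y ^ 24 := by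
      rw [j2Den, show w / y - 1 = (w - y) / y by field_simp,
        show w / y + 1 = (w + y) / y by field_simp,
        show (w / y) ^ 2 - 6 * (w / y) + 1 = (w ^ 2 - 6 * w * y + y ^ 2) / y ^ 2 by
          field_simp]
      field_simp
    rw [e, hu, h1, h2, h3, j22Den]
    ring
  have hnum : (w / y) ^ 8 + 232 * (w / y) ^ 7 + 732 * (w / y) ^ 6 - 1192 * (w / y) ^ 5
      + 710 * (w / y) ^ 4 - 1192 * (w / y) ^ 3 + 732 * (w / y) ^ 2 + 232 * (w / y) + 1 =
      2 ^ 16 * s ^ 4 * (x ^ 8 - 8 * x ^ 7 + 12 * x ^ 6 + 8 * x ^ 5 - 10 * x ^ 4 + 8 * x ^ 3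
        + 12 * x ^ 2 - 8 * x + 1) / y ^ 8 := by
    rw [eq_div_iff (pow_ne_zero 8 hy)]
    -- The numerator is palindromic, so its homogenization is a polynomial in w² + y² and wy, both
    -- already known in x.
    have e : ((w / y) ^ 8 + 232 * (w / y) ^ 7 + 732 * (w / y) ^ 6 - 1192 * (w / y) ^ 5
        + 710 * (w / y) ^ 4 - 1192 * (w / y) ^ 3 + 732 * (w / y) ^ 2 + 232 * (w / y) + 1) *
        y ^ 8 = (w ^ 2 + y ^ 2) ^ 4 + 232 * (w * y) * (w ^ 2 + y ^ 2) ^ 3 +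
        728 * (w * y) ^ 2 * (w ^ 2 + y ^ 2) ^ 2 - 1888 * (w * y) ^ 3 * (w ^ 2 + y ^ 2) -
        752 * (w * y) ^ 4 := by
      field_simp
      ring
    rw [e, hu, hv]
    ring
  have hden0 : 2 ^ 48 * s ^ 12 * j22Den x / y ^ 24 ≠ 0 :=
    div_ne_zero (mul_ne_zero (mul_ne_zero (by norm_num) (pow_ne_zero 12 hs0)) hx)
      (pow_ne_zero 24 hy)
  refine ⟨hy, hden ▸ hden0, ?_⟩
  rw [j2, j22, hden, hnum, div_eq_div_iff hx hden0]
  field_simp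

end OctavicCF

theorem proposition9 :
    (∀ τ : ℍ, OctavicCF.j2Den (OctavicCF.v τ ^ 2) ≠ 0 ∧
      OctavicCF.kleinJ τ = OctavicCF.j2 (OctavicCF.v τ ^ 2)) ∧
    (∀ τ : ℍ, OctavicCF.j22Den (OctavicCF.v τ ^ 2) ≠ 0 ∧
      OctavicCF.kleinJ (OctavicCF.fricke τ) = OctavicCF.j22 (OctavicCF.v τ ^ 2)) ∧
    (∀ x : ℂ, OctavicCF.j22Den x ≠ 0 →
      OctavicCF.sigma ^ 2 * x - 1 ≠ 0 ∧ OctavicCF.j2Den (OctavicCF.t x) ≠ 0 ∧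
      OctavicCF.j22 x = OctavicCF.j2 (OctavicCF.t x)) :=
  ⟨fun τ => ⟨OctavicCF.j2Den_v_sq_ne_zero τ, OctavicCF.kleinJ_eq_j2 τ⟩,
    fun τ => ⟨OctavicCF.j22Den_v_sq_ne_zero τ, OctavicCF.kleinJ_fricke_eq_j22 τ⟩,
    fun _ hx => OctavicCF.j22_eq_j2_comp_t hx⟩
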